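/- Let $q=e^{2\pi i\tau}$ with $\tau\in\mathfrak H$ (the upper half-plane), let $D=\frac1{2\pi i}\frac{d}{d\tau}$, let $\eta$ be the Dedekind eta function, $E_4$ the normalized Eisenstein series of weight $4$ and level $1$, and put $$t(\tau)=\frac{\eta(\tau)^8\eta(8\tau)^8}{\eta(2\tau)^8\eta(4\tau)^8},\qquad Y(\tau)=\frac{\eta(2\tau)^6\eta(4\tau)^6}{\eta(\tau)^4\eta(8\tau)^4},\qquad \Phi=\Bigl(\frac{Dt}{t}\Bigr)^3\frac{t}{Y(1-24t+16t^2)},$$ $$g_8(\tau)=\frac{E_4(\tau)-21E_4(2\tau)+84E_4(4\tau)-64E_4(8\tau)}{240},\qquad a_n=\sigma_3(n)-21\sigma_3(n/2)+84\sigma_3(n/4)-64\sigma_3(n/8),$$ where $\sigma_3(x)=0$ if $x$ is not an integer. Let $B_n^{(8)}\in\mathbb Q$ be given by $B_0^{(8)}=0$, $B_1^{(8)}=1$ and $$(n+1)^3B_{n+1}^{(8)}=(2n+1)(12n^2+12n+4)B_n^{(8)}-16n^3B_{n-1}^{(8)}\qquad(n\ge1),$$ and put $E(\tau)=\frac1{Y(\tau)}\sum_{n\ge0}B_n^{(8)}t(\tau)^n$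 wherever the series converges. Proposition. (i) $g_8=\sum_{n\ge1}a_nq^n$ on $\mathfrak H$, and $\Phi=g_8$: the two functions agree at every $\tau\in\mathfrak H$ with $1-24t(\tau)+16t(\tau)^2\ne0$, and at the remaining points $\Phi$ has a removable singularity with value $g_8(\tau)$. (ii) For every $\tau\in\mathfrak H$ the series and the integral (along the vertical ray from $\tau$) below converge absolutely, and $$\mathcal E(\tau):=\sum_{n\ge1}\frac{a_n}{n^3}q^n=-\frac{(2\pi i)^3}{2}\int_\tau^{i\infty}g_8(z)(z-\tau)^2\,dz ;$$ $\mathcal E$ is holomorphic on $\mathfrak H$. (iii) The series $\sum_n B_n^{(8)}t(\tau)^n$ converges for all $\tau$ with sufficiently large imaginary part, and on every connected open set $U\subset\mathfrak H$ that contains a half-plane $\operatorname{Im}\tau>c$ and on which this series converges absolutely one has $E=\mathcal E$, equivalently $$\sum_{n\ge0}B_n^{(8)}t(\tau)^n=\mathcal E(\tau)\,Y(\tau)\qquad(\tau\in U).$$ Any holomorphic function on $\mathfrak H$ that agrees with $E$ on some half-plane $\operatorname{Im}\tau>c$ equals $\mathcal E$. -/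

import Mathlib

open UpperHalfPlane Filter Topology

noncomputable section

namespace LevelEight

/-- The point `m τ` of the upper half-plane, for a positive integer `m`. -/
def dilate (m : ℕ+) (τ : ℍ) : ℍ :=
  ⟨((m : ℕ) : ℂ) * (τ : ℂ), by
    have hm : (0 : ℝ) < ((m : ℕ) : ℝ) := by exact_mod_cast m.pos
    simpa using mul_pos hm τ.im_pos⟩

/-- `η(m τ)`, with the Dedekind eta function of Mathlib. -/
def etaAt (m : ℕ+) (τ : ℍ) : ℂ := ModularForm.eta (dilate m τ : ℂ)

/-- The eta-quotient `t(τ) = η(τ)⁸ η(8τ)⁸ / (η(2τ)⁸ η(4τ)⁸)`. -/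
def t (τ : ℍ) : ℂ :=
  etaAt 1 τ ^ 8 * etaAt 8 τ ^ 8 / (etaAt 2 τ ^ 8 * etaAt 4 τ ^ 8)

/-- The eta-quotient `Y(τ) = η(2τ)⁶ η(4τ)⁶ / (η(τ)⁴ η(8τ)⁴)`. -/
def Y (τ : ℍ) : ℂ :=
  etaAt 2 τ ^ 6 * etaAt 4 τ ^ 6 / (etaAt 1 τ ^ 4 * etaAt 8 τ ^ 4)

/-- `Φ = (Dt/t)³ · t / (Y (1 - 24 t + 16 t²))`, where `D = (2πi)⁻¹ d/dτ`. -/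
def Phi (τ : ℍ) : ℂ :=
  (Derivative.normalizedDerivOfComplex t τ / t τ) ^ 3 *
    (t τ / (Y τ * (1 - 24 * t τ + 16 * t τ ^ 2)))

/-- `g₈(τ) = (E₄(τ) - 21 E₄(2τ) + 84 E₄(4τ) - 64 E₄(8τ)) / 240`. -/
def g8 (τ : ℍ) : ℂ :=
  (ModularForm.E₄ (dilate 1 τ) - 21 * ModularForm.E₄ (dilate 2 τ) +
    84 * ModularForm.E₄ (dilate 4 τ) - 64 * ModularForm.E₄ (dilate 8 τ)) / 240

/-- `σ₃(n / d)`, with the convention that it is `0` when `d` does not divide `n`. -/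
def sigma3Div (n d : ℕ) : ℤ :=
  if d ∣ n then (ArithmeticFunction.sigma 3 (n / d) : ℤ) else 0

/-- `aₙ = σ₃(n) - 21 σ₃(n/2) + 84 σ₃(n/4) - 64 σ₃(n/8)`. -/
def a (n : ℕ) : ℤ :=
  sigma3Div n 1 - 21 * sigma3Div n 2 + 84 * sigma3Div n 4 - 64 * sigma3Div n 8

/-- The rational companion sequence `Bₙ`, with `B₀ = 0`, `B₁ = 1`, solved from its three-term
recurrence (see `B_recurrence`). -/
def B : ℕ → ℚ
  | 0 => 0
  | 1 => 1
  | (n + 2) =>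
    ((2 * ((n : ℚ) + 1) + 1) * (12 * ((n : ℚ) + 1) ^ 2 + 12 * ((n : ℚ) + 1) + 4) * B (n + 1) -
      16 * ((n : ℚ) + 1) ^ 3 * B n) / ((n : ℚ) + 2) ^ 3

theorem B_recurrence (n : ℕ) (hn : 1 ≤ n) :
    ((n : ℚ) + 1) ^ 3 * B (n + 1) =
      (2 * (n : ℚ) + 1) * (12 * (n : ℚ) ^ 2 + 12 * (n : ℚ) + 4) * B n -
        16 * (n : ℚ) ^ 3 * B (n - 1) := by
  obtain ⟨m, rfl⟩ : ∃ m, n = m + 1 := ⟨n - 1, by omega⟩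
  have h : ((m : ℚ) + 2) ≠ 0 := by positivity
  have h2 : ((m : ℚ) + 1 + 1) = m + 2 := by ring
  rw [B]
  push_cast
  rw [h2]
  field_simp

/-- `q = e^{2πiτ}`. -/
def q (τ : ℍ) : ℂ := Complex.exp (2 * Real.pi * Complex.I * (τ : ℂ))

/-- The `n`-th term of the power series `∑ Bₙ zⁿ` at `z = t(τ)`. -/
def companionTerm (τ : ℍ) (n : ℕ) : ℂ := ((B n : ℚ) : ℂ) * t τ ^ n

/-- `E(τ) = (∑ Bₙ t(τ)ⁿ) / Y(τ)`; only meaningful where the series converges. -/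
def companionE (τ : ℍ) : ℂ := (∑' n : ℕ, companionTerm τ n) / Y τ

/-- The `n`-th term `(cₙ / n³) qⁿ` of the weight `-2` Eichler integral of `∑_{n ≥ 1} cₙ qⁿ`. -/
def eichlerTerm (c : ℕ → ℤ) (τ : ℍ) (n : ℕ+) : ℂ :=
  ((c n : ℤ) : ℂ) / (n : ℂ) ^ 3 * q τ ^ (n : ℕ)

/-- The weight `-2` Eichler integral `∑_{n ≥ 1} (cₙ / n³) qⁿ` of `∑_{n ≥ 1} cₙ qⁿ`. -/
def eichlerSeries (c : ℕ → ℤ) (τ : ℍ) : ℂ := ∑' n : ℕ+, eichlerTerm c τ n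

/-- The pullback of `f(z) (z - τ)² dz` to the vertical ray `z = τ + i y`, `y > 0`. -/
def eichlerIntegrand (f : ℍ → ℂ) (τ : ℍ) (y : ℝ) : ℂ :=
  f (ofComplex ((τ : ℂ) + Complex.I * (y : ℂ))) * (Complex.I * (y : ℂ)) ^ 2 * Complex.I

/-- `-((2πi)³ / 2) ∫_τ^{i∞} f(z) (z - τ)² dz`, along the vertical ray from `τ`. -/
def eichlerIntegral (f : ℍ → ℂ) (τ : ℍ) : ℂ :=
  -((2 * Real.pi * Complex.I) ^ 3 / 2) *
    ∫ y in Set.Ioi (0 : ℝ), eichlerIntegrand f τ y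

/-- The set `U` contains a half-plane `Im τ > c`, i.e. a neighbourhood of the cusp `i∞`. -/
def ContainsHalfPlane (U : Set ℍ) : Prop := ∃ c : ℝ, ∀ τ : ℍ, c < τ.im → τ ∈ U

end LevelEight

end

noncomputable section

namespace LevelEight

open scoped MatrixGroups ModularForm Manifold Real
open EisensteinSeries (E2)
open ModularForm (eta eta_ne_zero)
open Function.Periodic (qParam qParam_ne_zero norm_qParam)

/-! The three-term recurrence is a third-order differential equation for the companion series in the
variable `t`. Substituting `t(τ)` and dividing by `Y` turns that equation into `D³E = g₈`. Since `g₈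
= ∑ aₙ qⁿ`, the series `∑ aₙ n⁻³ qⁿ` satisfies the same equation. Both functions and their first two
`D`-derivatives tend to `0` at `i∞`, so they agree near `i∞`, and the identity theorem extends the
equality.

The modular input is a uniformization. With `x = θ₃(4τ)²`, `z = θ₂(4τ)²` and `e = E₂(4τ)`, the
polynomials in `x, z, e` are closed under `D` (`hasD_ux`, `hasD_uz`, `hasD_ue`). Moreover `t =
z(x-z)/(4x(x+z))`, `Y = x(x+z)` and `Dt/t = s` with `s = x² - 2xz - z²`. The two relations `Y²(1 -
24t + 16t²) = s²` (`quadratic_t`) and `g₈ = Y t s` (`g8_eq_mul`) give `Φ = g₈` at once. They also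
reduce `D³E = g₈` (`hasD_compF2`) to polynomial algebra and `companion_ode`.

The theta constants are defined as eta quotients. Their identities (`jacobi`, `E2_relation_theta4`,
`E4_eq_theta`) and Ramanujan's formula for `DE₂` rest on one principle: a level-one form of weight
below `12` that vanishes at `i∞` is zero. Landen's transformation (`theta3_sq`) then moves
everything to the argument `4τ`.

The integral formula is termwise integration, with `∫ y² exp(-2πny) dy = 2/(2πn)³` producing the
factor `n⁻³`. -/

/-! ### Level one forms -/

/-- A holomorphic function of weight `k < 12` that is invariant under `SL(2, ℤ)` and vanishes at
`i∞` is zero. -/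
theorem eq_zero_of_levelOne {k : ℤ} (hk : k < 12) {f : ℍ → ℂ} (hf : MDiff f)
    (hS : f ∣[k] ModularGroup.S = f) (hT : f ∣[k] ModularGroup.T = f)
    (h0 : Tendsto f atImInfty (𝓝 0)) : f = 0 := by
  let g : CuspForm 𝒮ℒ k :=
    { toFun := f
      slash_action_eq' := by
        rintro A ⟨A, rfl⟩
        exact SlashInvariantForm.slash_action_generators_SL2Z hS hT A
      holo' := hf
      zero_at_cusps' := by
        intro c hc
        rw [Subgroup.IsArithmetic.isCusp_iff_isCusp_SL2Z] at hc
        rw [OnePoint.isZeroAt_iff_forall_SL2Z hc]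
        intro γ _
        rw [SlashInvariantForm.slash_action_generators_SL2Z hS hT]
        exact h0 }
  have hg : g = 0 := rank_zero_iff_forall_zero.mp (CuspForm.rank_eq_zero_of_weight_lt_twelve hk) g
  have : (g : ℍ → ℂ) = 0 := by rw [hg]; rfl
  exact this

/-! ### The normalized derivative as a relation -/

/-- `f` is differentiable at `τ` with `(2πi)⁻¹ df/dτ = f'`. -/
def HasD (f : ℍ → ℂ) (f' : ℂ) (τ : ℍ) : Prop :=
  HasDerivAt (f ∘ ofComplex) (2 * π * Complex.I * f') (τ : ℂ)

variable {f g : ℍ → ℂ} {f' g' : ℂ} {τ : ℍ}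

theorem HasD.normalizedDeriv_eq (h : HasD f f' τ) :
    Derivative.normalizedDerivOfComplex f τ = f' := by
  rw [Derivative.normalizedDerivOfComplex, h.deriv, inv_mul_cancel_left₀ Complex.two_pi_I_ne_zero]

theorem hasD_of_mdiff (h : MDiff f) (τ : ℍ) :
    HasD f (Derivative.normalizedDerivOfComplex f τ) τ := by
  rw [HasD, Derivative.normalizedDerivOfComplex, mul_inv_cancel_left₀ Complex.two_pi_I_ne_zero]
  exact (UpperHalfPlane.mdifferentiableAt_iff.mp (h τ)).hasDerivAt

theorem mdiff_of_hasD {F : ℍ → ℂ} (h : ∀ τ, HasD f (F τ) τ) : MDiff f :=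
  fun τ => UpperHalfPlane.mdifferentiableAt_iff.mpr (h τ).differentiableAt

/-- This is how functional identities get differentiated: two computations of the derivative of one
function are equated. -/
theorem HasD.unique (h : HasD f f' τ) (h' : HasD f g' τ) : f' = g' :=
  h.normalizedDeriv_eq.symm.trans h'.normalizedDeriv_eq

theorem HasD.congr_deriv (h : HasD f f' τ) (e : f' = g') : HasD f g' τ := e ▸ h

theorem eventually_coe_of_eventually {p : ℍ → Prop} (h : ∀ᶠ σ in 𝓝 τ, p σ) :
    ∀ᶠ z in 𝓝 (τ : ℂ), p (ofComplex z) := by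
  have hc : ContinuousAt (fun z : ℂ => ofComplex z) (τ : ℂ) :=
    (mdifferentiableAt_ofComplex τ.im_pos).continuousAt
  rw [ContinuousAt, ofComplex_apply] at hc
  exact hc.eventually h

theorem HasD.congr (h : HasD f f' τ) (e : ∀ᶠ σ in 𝓝 τ, g σ = f σ) : HasD g f' τ :=
  HasDerivAt.congr_of_eventuallyEq h (eventually_coe_of_eventually e)

theorem hasD_const (c : ℂ) : HasD (fun _ => c) 0 τ := by
  simpa [HasD] using! hasDerivAt_const (τ : ℂ) c

theorem HasD.add (hf : HasD f f' τ) (hg : HasD g g' τ) :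
    HasD (fun σ => f σ + g σ) (f' + g') τ := by
  rw [HasD, mul_add]; exact HasDerivAt.add hf hg

theorem HasD.sub (hf : HasD f f' τ) (hg : HasD g g' τ) :
    HasD (fun σ => f σ - g σ) (f' - g') τ := by
  rw [HasD, mul_sub]; exact HasDerivAt.sub hf hg

theorem HasD.mul (hf : HasD f f' τ) (hg : HasD g g' τ) :
    HasD (fun σ => f σ * g σ) (f' * g τ + f τ * g') τ := by
  have := HasDerivAt.mul hf hg
  simp only [Function.comp_apply, ofComplex_apply] at this
  exact this.congr_deriv (by ring)

theorem HasD.const_mul (c : ℂ) (hf : HasD f f' τ) : HasD (fun σ => c * f σ) (c * f') τ :=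
  ((hasD_const c).mul hf).congr_deriv (by ring)

theorem HasD.pow (n : ℕ) (hf : HasD f f' τ) :
    HasD (fun σ => f σ ^ n) (n * f τ ^ (n - 1) * f') τ := by
  have := HasDerivAt.pow hf n
  simp only [Function.comp_apply, ofComplex_apply] at this
  exact this.congr_deriv (by ring)

theorem HasD.div (hf : HasD f f' τ) (hg : HasD g g' τ) (h0 : g τ ≠ 0) :
    HasD (fun σ => f σ / g σ) ((f' * g τ - f τ * g') / g τ ^ 2) τ := by
  have := HasDerivAt.div hf hg (by simpa using h0)
  simp only [Function.comp_apply, ofComplex_apply] at this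
  exact this.congr_deriv (by ring)

/-- Chain rule for an outer function on `ℂ`. -/
theorem HasD.comp {G : ℂ → ℂ} {G' : ℂ} (hG : HasDerivAt G G' (f τ)) (hf : HasD f f' τ) :
    HasD (fun σ => G (f σ)) (G' * f') τ := by
  have h1 : HasDerivAt G G' ((f ∘ ofComplex) (τ : ℂ)) := by simpa using hG
  exact (HasDerivAt.comp (τ : ℂ) h1 hf).congr_deriv (by ring)

/-- Chain rule for an inner self-map of the upper half-plane. -/
theorem HasD.chain {φ : ℍ → ℍ} {ψ : ℂ → ℂ} {c : ℂ} (hφ : ∀ σ : ℍ, (φ σ : ℂ) = ψ σ)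
    (hψ : HasDerivAt ψ c (τ : ℂ)) (h : HasD f f' (φ τ)) :
    HasD (fun σ => f (φ σ)) (c * f') τ := by
  have h1 : HasDerivAt (f ∘ ofComplex) (2 * π * Complex.I * f') (ψ (τ : ℂ)) := by
    rw [← hφ]; exact h
  refine (HasDerivAt.congr_of_eventuallyEq (HasDerivAt.comp (τ : ℂ) h1 hψ) ?_).congr_deriv (by ring)
  filter_upwards [isOpen_upperHalfPlaneSet.mem_nhds τ.im_pos] with z hz
  have := hφ ⟨z, hz⟩
  simp only [Function.comp_apply, ofComplex_apply_of_im_pos hz]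
  rw [← ofComplex_apply (φ ⟨z, hz⟩), this]

theorem HasD.scale {c : ℂ} {φ : ℍ → ℍ} (hφ : ∀ σ, (φ σ : ℂ) = c * σ) (h : HasD f f' (φ τ)) :
    HasD (fun σ => f (φ σ)) (c * f') τ :=
  h.chain (ψ := fun z => c * z) hφ (by simpa using (hasDerivAt_id (τ : ℂ)).const_mul c)

/-- If `f` is holomorphic and has a limit at `i∞`, then its derivative tends to `0` there. -/
theorem tendsto_normalizedDeriv_zero (hf : MDiff f) {c : ℂ} (h : Tendsto f atImInfty (𝓝 c)) :
    Tendsto (Derivative.normalizedDerivOfComplex f) atImInfty (𝓝 0) := by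
  suffices H : Tendsto (fun τ : ℍ => deriv (f ∘ ofComplex) τ) atImInfty (𝓝 0) by
    have := H.const_mul ((2 * π * Complex.I)⁻¹)
    rw [mul_zero] at this
    exact this
  rw [Metric.tendsto_nhds]
  intro ε hε
  have h1 := Metric.tendsto_nhds.mp h (ε / 2) (half_pos hε)
  obtain ⟨A, hA⟩ := (atImInfty_mem _).mp h1
  -- The extra `1` keeps the closed unit disc about `τ` above height `max A 1`, hence inside the
  -- half-plane where the bound holds; Cauchy's estimate on that disc finishes.
  refine (atImInfty_mem _).mpr ⟨max A 1 + 1, fun τ hτ => ?_⟩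
  have hball : ∀ z ∈ Metric.closedBall (τ : ℂ) 1, max A 1 ≤ z.im := by
    intro z hz
    have h2 : |(z - τ).im| ≤ 1 := (Complex.abs_im_le_norm _).trans (by
      simpa [dist_eq_norm] using hz)
    have h3 := (abs_le.mp h2).1
    rw [Complex.sub_im, coe_im] at h3
    linarith
  have hpos : ∀ z ∈ Metric.closedBall (τ : ℂ) 1, 0 < z.im := fun z hz =>
    lt_of_lt_of_le one_pos ((le_max_right _ _).trans (hball z hz))
  have hd : DifferentiableOn ℂ (fun z => (f ∘ ofComplex) z - c) (Metric.closedBall (τ : ℂ) 1) :=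
    ((UpperHalfPlane.mdifferentiable_iff.mp hf).mono hpos).sub_const c
  have key := Complex.norm_deriv_le_of_forall_mem_sphere_norm_le (C := ε / 2) one_pos
    (hd.diffContOnCl_ball subset_rfl) (fun z hz => by
      have hz' := Metric.sphere_subset_closedBall hz
      have := hA ⟨z, hpos z hz'⟩ ((le_max_left _ _).trans (hball z hz'))
      simp only [Function.comp_apply, ofComplex_apply_of_im_pos (hpos z hz')]
      rw [← dist_eq_norm]
      exact le_of_lt this)
  rw [deriv_sub_const] at key
  change dist _ _ < ε
  rw [dist_zero_right]
  linarith

/-! ### The Dedekind eta function -/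

theorem hasD_eta (τ : ℍ) : HasD (fun σ => eta σ) (eta τ * E2 τ / 24) τ := by
  have h1 := (ModularForm.differentiableAt_eta_of_mem_upperHalfPlaneSet τ.2).hasDerivAt
  have h2 := ModularForm.logDeriv_eta_eq_E2 τ
  rw [logDeriv_apply, div_eq_iff (eta_ne_zero τ.2)] at h2
  refine HasDerivAt.congr_of_eventuallyEq (h1.congr_deriv (h2.trans ?_)) ?_
  · ring
  · filter_upwards [isOpen_upperHalfPlaneSet.mem_nhds τ.im_pos] with z hz
    simp [ofComplex_apply_of_im_pos hz]

/-- The fourth power removes the square root in the transformation law of `η`, so no branch has to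
be tracked. -/
theorem eta_S_pow_four (τ : ℍ) : eta (-1 / (τ : ℂ)) ^ 4 = -(τ : ℂ) ^ 2 * eta τ ^ 4 := by
  have h := ModularForm.eta_comp_eq_csqrt_I_inv τ.2
  simp only [Function.comp_apply, Pi.smul_apply, Pi.mul_apply, smul_eq_mul] at h
  have hs : ∀ z : ℂ, z ≠ 0 → Complex.sqrt z ^ 4 = z ^ 2 := by
    intro z hz
    rw [sqrt_eq_exp hz, ← Complex.exp_nat_mul]
    rw [show ((4 : ℕ) : ℂ) * (Complex.log z / 2) = (2 : ℕ) * Complex.log z by push_cast; ring,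
      Complex.exp_nat_mul, Complex.exp_log hz]
  rw [h, mul_pow, mul_pow, inv_pow, hs _ Complex.I_ne_zero, hs _ τ.ne_zero, Complex.I_sq]
  ring

/-- `ζ₂₄ = e^{2πi/24}`. -/
def zeta24 : ℂ := Complex.exp (2 * π * Complex.I / 24)

theorem zeta24_pow : zeta24 ^ 12 = -1 := by
  rw [zeta24, ← Complex.exp_nat_mul, ← Complex.exp_pi_mul_I]
  congr 1; push_cast; ring

theorem qParam_one_add (z : ℂ) : qParam 1 (z + 1) = qParam 1 z := by
  simp [qParam, mul_add, Complex.exp_add]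

theorem eta_add_one (z : ℂ) : eta (z + 1) = zeta24 * eta z := by
  rw [eta, eta, ← mul_assoc]
  congr 1
  · rw [qParam, qParam, zeta24, ← Complex.exp_add]
    congr 1; push_cast; ring
  · simp only [ModularForm.eta_q, qParam_one_add]

theorem eta_add_two (z : ℂ) : eta (z + 2) = zeta24 ^ 2 * eta z := by
  rw [show z + 2 = z + 1 + 1 by ring, eta_add_one, eta_add_one]; ring

/-! ### Euler products and the value of `η` at `τ + 1/2`. -/

/-- The Euler product `∏ (1 - xⁿ)`. -/
def euler (x : ℂ) : ℂ := ∏' n : ℕ, (1 - x ^ (n + 1))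

def eulerOdd (x : ℂ) : ℂ := ∏' n : ℕ, (1 - x ^ (2 * n + 1))

theorem multipliable_odd {x : ℂ} (hx : ‖x‖ < 1) : Multipliable fun n : ℕ => 1 - x ^ (2 * n + 1) := by
  have h : Summable fun n : ℕ => ‖-x ^ (2 * n + 1)‖ := by
    have h2 : ‖x‖ ^ 2 < 1 := pow_lt_one₀ (norm_nonneg _) hx (by omega)
    simpa [pow_succ, pow_mul] using
      (summable_geometric_of_lt_one (by positivity) h2).mul_right ‖x‖
  simpa [sub_eq_add_neg] using multipliable_one_add_of_summable h

theorem euler_eq {x : ℂ} (hx : ‖x‖ < 1) : euler x = eulerOdd x * euler (x ^ 2) := by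
  have h2 : ‖x ^ 2‖ < 1 := by
    rw [norm_pow]; exact pow_lt_one₀ (norm_nonneg _) hx (by omega)
  have h1 : HasProd (fun k : ℕ => 1 - x ^ (2 * k + 1)) (eulerOdd x) := (multipliable_odd hx).hasProd
  have h3 : HasProd (fun k : ℕ => 1 - x ^ (2 * k + 1 + 1)) (euler (x ^ 2)) := by
    have := (ModularForm.multipliable_one_sub_pow h2).hasProd
    convert! this using 2 with n
    rw [← pow_mul]; ring_nf
  exact (HasProd.even_mul_odd (f := fun n : ℕ => 1 - x ^ (n + 1)) h1 h3).tprod_eq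

theorem eulerOdd_neg_mul {x : ℂ} (hx : ‖x‖ < 1) :
    eulerOdd (-x) * eulerOdd x = eulerOdd (x ^ 2) := by
  rw [eulerOdd, eulerOdd, ← Multipliable.tprod_mul (multipliable_odd (by simpa using hx))
    (multipliable_odd hx), eulerOdd]
  congr 1; ext n
  have : (-x) ^ (2 * n + 1) = - x ^ (2 * n + 1) := Odd.neg_pow ⟨n, rfl⟩ x
  rw [this, ← pow_mul, show 2 * (2 * n + 1) = (2 * n + 1) + (2 * n + 1) by ring, pow_add]
  ring

/-- Split each product by the parity of the exponent. The even parts at `x` and `-x` coincide, and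
the odd parts multiply to the odd part at `x²`. -/
theorem euler_neg {x : ℂ} (hx : ‖x‖ < 1) :
    euler (-x) * (euler x * euler (x ^ 4)) = euler (x ^ 2) ^ 3 := by
  have h2 : ‖x ^ 2‖ < 1 := by
    rw [norm_pow]; exact pow_lt_one₀ (norm_nonneg _) hx (by omega)
  have e1 := euler_eq hx
  have e2 := euler_eq (x := -x) (by simpa using hx)
  have e3 := euler_eq h2
  have e4 := eulerOdd_neg_mul hx
  rw [neg_sq] at e2
  rw [← pow_mul] at e3
  rw [e2, e1]
  calc _ = (eulerOdd (-x) * eulerOdd x) * euler (x ^ (2 * 2)) * euler (x ^ 2) ^ 2 := by ring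
    _ = _ := by rw [e4, ← e3]; ring

theorem eta_eq_euler (z : ℂ) :
    eta z = qParam 24 z * euler (qParam 1 z) := rfl

/-- The eighth power of the classical `η(τ + 1/2) = ζ₄₈ η(2τ)³ / (η(τ) η(4τ))`. It is what lets `T`
be followed on `η(τ/2)`, hence on `θ₄`. -/
theorem eta_add_half (τ : ℍ) :
    eta ((τ : ℂ) + 1 / 2) ^ 8 * (eta τ ^ 8 * eta (4 * τ) ^ 8) =
      zeta24 ^ 4 * eta (2 * τ) ^ 24 := by
  set x := qParam 1 (τ : ℂ) with hx
  have hx1 : ‖x‖ < 1 := by simpa using norm_qParam_lt_one 1 τ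
  have q1 : qParam 1 ((τ : ℂ) + 1 / 2) = -x := by
    rw [hx, qParam, qParam, Complex.ofReal_one, div_one, div_one,
      show 2 * π * Complex.I * ((τ : ℂ) + 1 / 2) = 2 * π * Complex.I * τ + π * Complex.I by ring,
      Complex.exp_add, Complex.exp_pi_mul_I, mul_neg_one]
  have q2 : qParam 1 (2 * (τ : ℂ)) = x ^ 2 := by
    rw [hx, qParam, qParam, ← Complex.exp_nat_mul]
    congr 1; push_cast; ring
  have q4 : qParam 1 (4 * (τ : ℂ)) = x ^ 4 := by
    rw [hx, qParam, qParam, ← Complex.exp_nat_mul]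
    congr 1; push_cast; ring
  have e := euler_neg hx1
  simp only [eta_eq_euler, q1, q2, q4, ← hx, mul_pow]
  have hq : qParam 24 ((τ : ℂ) + 1 / 2) ^ 8 * (qParam 24 (τ : ℂ) ^ 8 *
      qParam 24 (4 * (τ : ℂ)) ^ 8) =
      zeta24 ^ 4 * qParam 24 (2 * (τ : ℂ)) ^ 24 := by
    simp only [qParam, zeta24, ← Complex.exp_nat_mul, ← Complex.exp_add]
    congr 1; push_cast; ring
  calc _ = (qParam 24 ((τ : ℂ) + 1 / 2) ^ 8 * (qParam 24 (τ : ℂ) ^ 8 *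
      qParam 24 (4 * (τ : ℂ)) ^ 8)) *
      (euler (-x) * (euler x * euler (x ^ 4))) ^ 8 := by ring
    _ = _ := by rw [hq, e]; ring

theorem tendsto_qParam {h : ℝ} (hh : 0 < h) :
    Tendsto (fun τ : ℍ => qParam h τ) atImInfty (𝓝 0) :=
  UpperHalfPlane.qParam_tendsto_atImInfty hh

theorem tendsto_euler : Tendsto euler (𝓝 0) (𝓝 1) := by
  have h := ModularForm.differentiableOn_tprod_one_sub_pow.continuousOn.continuousAt
    (Metric.isOpen_ball.mem_nhds (Metric.mem_ball_self one_pos))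
  have h0 : euler 0 = 1 := by simp [euler]
  have : Tendsto euler (𝓝 0) (𝓝 (euler 0)) := h
  rwa [h0] at this

/-! ### Power series and the operator `θ = w d/dw` -/

/-- The power series `∑ cₙ wⁿ` converges absolutely for `‖w‖ < R`. -/
def ConvergesIn (c : ℕ → ℂ) (R : ℝ) : Prop :=
  ∀ r : ℝ, 0 ≤ r → r < R → Summable fun n => ‖c n‖ * r ^ n

/-- The sum of a power series. -/
def powerSum (c : ℕ → ℂ) (w : ℂ) : ℂ := ∑' n, c n * w ^ n

variable {c : ℕ → ℂ} {R : ℝ}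

theorem ConvergesIn.hasSum (hc : ConvergesIn c R) {w : ℂ} (hw : ‖w‖ < R) :
    HasSum (fun n => c n * w ^ n) (powerSum c w) := by
  refine (Summable.of_norm ?_).hasSum
  simpa [norm_mul, norm_pow] using hc ‖w‖ (norm_nonneg _) hw

theorem ConvergesIn.mono (hc : ConvergesIn c R) {d : ℕ → ℂ} (h : ∀ n, ‖d n‖ ≤ ‖c n‖) :
    ConvergesIn d R := fun r h0 hr =>
  (hc r h0 hr).of_nonneg_of_le (fun n => by positivity)
    fun n => mul_le_mul_of_nonneg_right (h n) (pow_nonneg h0 n)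

/-- A power series with summable terms at one point converges in the corresponding disc. -/
theorem convergesIn_of_summable {w : ℂ} (h : Summable fun n => c n * w ^ n) :
    ConvergesIn c ‖w‖ := by
  intro r h0 hr
  have hw : 0 < ‖w‖ := h0.trans_lt hr
  obtain ⟨C, hC⟩ := h.tendsto_atTop_zero.norm.bddAbove_range
  have hg : Summable fun n : ℕ => C * (r / ‖w‖) ^ n :=
    (summable_geometric_of_lt_one (by positivity) ((div_lt_one hw).mpr hr)).mul_left C
  refine hg.of_nonneg_of_le (fun n => by positivity) fun n => ?_
  have h1 : ‖c n‖ * ‖w‖ ^ n ≤ C := by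
    have := hC ⟨n, rfl⟩
    simpa [norm_mul, norm_pow] using this
  have h2 : r ^ n = ‖w‖ ^ n * (r / ‖w‖) ^ n := by
    rw [← mul_pow, mul_div_cancel₀ _ hw.ne']
  rw [h2, ← mul_assoc]
  exact mul_le_mul_of_nonneg_right h1 (by positivity)

/-- Comparison at a radius `s` between `r` and `R`: the gap absorbs the factor `n`, because `n
(r/s)ⁿ⁻¹` is bounded. -/
theorem ConvergesIn.summable_deriv (hc : ConvergesIn c R) {r : ℝ} (h0 : 0 ≤ r) (hr : r < R) :
    Summable fun n : ℕ => ‖c n‖ * (n * r ^ (n - 1)) := by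
  obtain ⟨s, hrs, hsR⟩ := exists_between hr
  have hs : 0 < s := h0.trans_lt hrs
  have hq : ‖r / s‖ < 1 := by
    rw [Real.norm_of_nonneg (by positivity)]; exact (div_lt_one hs).mpr hrs
  have ht : Tendsto (fun n : ℕ => ((n : ℝ) ^ 1 * (r / s) ^ (n - 1))) atTop (𝓝 0) := by
    rw [← tendsto_add_atTop_iff_nat 1]
    have h1 := tendsto_pow_const_mul_const_pow_of_abs_lt_one 1 hq
    have h2 := tendsto_pow_const_mul_const_pow_of_abs_lt_one 0 hq
    simpa [add_mul] using h1.add h2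
  obtain ⟨C, hC⟩ := ht.bddAbove_range
  refine (((hc s hs.le hsR).mul_left (C / s)).of_nonneg_of_le (fun n => by positivity) fun n => ?_)
  rcases n with _ | n
  · have : 0 ≤ C := by simpa using hC ⟨0, rfl⟩
    simp; positivity
  · have h1 : ((n + 1 : ℕ) : ℝ) * (r / s) ^ n ≤ C := by simpa using hC ⟨n + 1, rfl⟩
    have h2 : r ^ n = s ^ n * (r / s) ^ n := by rw [← mul_pow, mul_div_cancel₀ _ hs.ne']
    have h3 : C / s * (‖c (n + 1)‖ * s ^ (n + 1)) = ‖c (n + 1)‖ * (s ^ n * C) := by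
      rw [pow_succ]; field_simp
    rw [h3, Nat.add_sub_cancel, h2]
    refine mul_le_mul_of_nonneg_left ?_ (norm_nonneg _)
    calc _ = s ^ n * (((n + 1 : ℕ) : ℝ) * (r / s) ^ n) := by ring
      _ ≤ _ := mul_le_mul_of_nonneg_left h1 (by positivity)

theorem ConvergesIn.theta (hc : ConvergesIn c R) : ConvergesIn (fun n => n * c n) R := by
  intro r h0 hr
  refine ((hc.summable_deriv h0 hr).mul_left r).congr fun n => ?_
  rcases n with _ | n
  · simp
  · rw [norm_mul, Complex.norm_natCast, Nat.add_sub_cancel, pow_succ]; ring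

/-- Termwise differentiation of a power series. -/
theorem ConvergesIn.hasDerivAt (hc : ConvergesIn c R) {w : ℂ} (hw : ‖w‖ < R) :
    HasDerivAt (powerSum c) (∑' n : ℕ, c n * (n * w ^ (n - 1))) w := by
  obtain ⟨r, hwr, hrR⟩ := exists_between hw
  have h0 : 0 < r := (norm_nonneg _).trans_lt hwr
  refine hasDerivAt_tsum_of_isPreconnected (hc.summable_deriv h0.le hrR) Metric.isOpen_ball
    (convex_ball (0 : ℂ) r).isPreconnected (fun n y _ => (hasDerivAt_pow n y).const_mul (c n))
    (fun n y hy => ?_) (Metric.mem_ball_self h0) ?_ (by simpa using hwr)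
  · have hy' : ‖y‖ ≤ r := by simpa using (Metric.mem_ball.mp hy).le
    rw [norm_mul, norm_mul, norm_pow, Complex.norm_natCast]
    gcongr
  · exact (hc.hasSum (by simpa using h0.trans hrR)).summable

theorem mul_deriv_powerSum (c : ℕ → ℂ) (w : ℂ) :
    w * (∑' n : ℕ, c n * (n * w ^ (n - 1))) = powerSum (fun n => n * c n) w := by
  rw [← tsum_mul_left, powerSum]
  congr 1; ext n
  rcases n with _ | n
  · simp
  · simp [pow_succ]; ring

theorem ConvergesIn.analyticAt (hc : ConvergesIn c R) {w : ℂ} (hw : ‖w‖ < R) :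
    AnalyticAt ℂ (powerSum c) w := by
  have hd : DifferentiableOn ℂ (powerSum c) (Metric.ball 0 R) := fun z hz =>
    (hc.hasDerivAt (by simpa using hz)).differentiableAt.differentiableWithinAt
  exact hd.analyticAt (Metric.isOpen_ball.mem_nhds (by simpa using hw))

theorem powerSum_zero (c : ℕ → ℂ) : powerSum c 0 = c 0 := by
  rw [powerSum, tsum_eq_single 0 (fun n hn => by simp [hn])]; simp

/-- `D (∑ cₙ fⁿ) = (D f / f) ∑ n cₙ fⁿ`, where `D f = f * s`. -/
theorem ConvergesIn.hasD (hc : ConvergesIn c R) {f : ℍ → ℂ} {s : ℂ} {τ : ℍ} (hw : ‖f τ‖ < R)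
    (hf : HasD f (f τ * s) τ) :
    HasD (fun σ => powerSum c (f σ)) (s * powerSum (fun n => n * c n) (f τ)) τ := by
  refine (HasD.comp (hc.hasDerivAt hw) hf).congr_deriv ?_
  rw [← mul_deriv_powerSum]; ring

/-- Polynomially bounded coefficients give convergence in the unit disc. -/
theorem convergesIn_one_of_le {C : ℝ} {k : ℕ} (h : ∀ n, ‖c n‖ ≤ C * (n : ℝ) ^ k) :
    ConvergesIn c 1 := by
  intro r h0 hr
  have := (summable_pow_mul_geometric_of_norm_lt_one k
    (by rwa [Real.norm_of_nonneg h0] : ‖r‖ < 1)).mul_left C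
  refine this.of_nonneg_of_le (fun n => by positivity) fun n => ?_
  rw [← mul_assoc]
  exact mul_le_mul_of_nonneg_right (h n) (pow_nonneg h0 n)

/-! ### `q`-series -/

theorem q_eq_qParam (τ : ℍ) : q τ = qParam 1 τ := by
  simp [q, qParam]

theorem norm_q_lt_one (τ : ℍ) : ‖q τ‖ < 1 := norm_exp_two_pi_I_lt_one τ

theorem tendsto_q : Tendsto q atImInfty (𝓝 0) := by
  simpa only [← q_eq_qParam] using tendsto_qParam one_pos

theorem hasD_q (τ : ℍ) : HasD q (q τ * 1) τ := by
  have h1 : HasDerivAt (fun z : ℂ => Complex.exp (2 * π * Complex.I * z))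
      (Complex.exp (2 * π * Complex.I * τ) * (2 * π * Complex.I * 1)) (τ : ℂ) :=
    ((hasDerivAt_id (τ : ℂ)).const_mul _).cexp
  refine HasDerivAt.congr_of_eventuallyEq (h1.congr_deriv ?_) ?_
  · rw [q]; ring
  · filter_upwards [isOpen_upperHalfPlaneSet.mem_nhds τ.im_pos] with z hz
    simp [q, ofComplex_apply_of_im_pos hz]

theorem hasD_qSeries (hc : ConvergesIn c 1) (τ : ℍ) :
    HasD (fun σ => powerSum c (q σ)) (powerSum (fun n => n * c n) (q τ)) τ := by
  simpa using hc.hasD (norm_q_lt_one τ) (hasD_q τ)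

theorem tendsto_powerSum {f : ℍ → ℂ} {l : Filter ℍ} (hR : 0 < R) (hc : ConvergesIn c R)
    (hf : Tendsto f l (𝓝 0)) : Tendsto (fun τ => powerSum c (f τ)) l (𝓝 (c 0)) := by
  have h := (hc.hasDerivAt (w := 0) (by simpa using hR)).continuousAt.tendsto
  rw [powerSum_zero] at h
  exact h.comp hf

theorem tendsto_qSeries (hc : ConvergesIn c 1) :
    Tendsto (fun τ => powerSum c (q τ)) atImInfty (𝓝 (c 0)) :=
  tendsto_powerSum one_pos hc tendsto_q

/-! ### Eisenstein series -/

theorem norm_sigma_le (k n : ℕ) : ‖(ArithmeticFunction.sigma k n : ℂ)‖ ≤ (n : ℝ) ^ (k + 1) := by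
  rw [Complex.norm_natCast]
  exact_mod_cast ArithmeticFunction.sigma_le_pow_succ k n

/-- Coefficients of `E₂`. -/
def coeffE2 (n : ℕ) : ℂ := if n = 0 then 1 else -24 * ArithmeticFunction.sigma 1 n

/-- Coefficients of `(E₄ - 1) / 240`. -/
def coeffE4 (n : ℕ) : ℂ := ArithmeticFunction.sigma 3 n

theorem convergesIn_coeffE4 : ConvergesIn coeffE4 1 :=
  convergesIn_one_of_le (C := 1) (k := 4) fun n => by
    simpa [coeffE4] using norm_sigma_le 3 n

theorem convergesIn_coeffE2 : ConvergesIn coeffE2 1 := by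
  intro r h0 hr
  have h : ConvergesIn (fun n => (ArithmeticFunction.sigma 1 n : ℂ)) 1 :=
    convergesIn_one_of_le (C := 1) (k := 2) fun n => by simpa using norm_sigma_le 1 n
  refine (summable_nat_add_iff 1).mp ((((summable_nat_add_iff 1).mpr (h r h0 hr)).mul_left
    24).congr fun n => ?_)
  simp [coeffE2]; ring

theorem E2_eq_powerSum (τ : ℍ) : E2 τ = powerSum coeffE2 (q τ) :=
  (EisensteinSeries.hasSum_qExpansion_E2 τ).tsum_eq.symm

theorem tendsto_E2 : Tendsto E2 atImInfty (𝓝 1) := by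
  have := tendsto_qSeries convergesIn_coeffE2
  simp only [← E2_eq_powerSum] at this
  simpa [coeffE2] using! this

theorem E4_eq_powerSum (τ : ℍ) : ModularForm.E₄ τ = 1 + 240 * powerSum coeffE4 (q τ) := by
  have h := EisensteinSeries.q_expansion_bernoulli (k := 4) (by norm_num) ⟨2, rfl⟩ τ
  have hb : bernoulli 4 = -1 / 30 := by decide +kernel
  rw [hb] at h
  refine h.trans ?_
  have h2 : ∑' n : ℕ+, (ArithmeticFunction.sigma (4 - 1) n : ℂ) *
      Complex.exp (2 * π * Complex.I * τ) ^ ((n : ℕ) : ℤ) = powerSum coeffE4 (q τ) := by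
    simp only [zpow_natCast]
    rw [tsum_pnat_eq_tsum_succ (f := fun n => (ArithmeticFunction.sigma (4 - 1) n : ℂ) *
      Complex.exp (2 * π * Complex.I * τ) ^ n), powerSum,
      (convergesIn_coeffE4.hasSum (norm_q_lt_one τ)).summable.tsum_eq_zero_add]
    simp [coeffE4, q]
  rw [h2]; norm_num

theorem tendsto_E4 : Tendsto ModularForm.E₄ atImInfty (𝓝 1) := by
  have := ((tendsto_qSeries convergesIn_coeffE4).const_mul 240).const_add 1
  simp only [← E4_eq_powerSum] at this
  simpa [coeffE4] using! this

/-- The action of `S` on `E₂`. -/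
theorem E2_S (τ : ℍ) :
    E2 (ModularGroup.S • τ) = (τ : ℂ) ^ 2 * E2 τ + 6 * τ / (π * Complex.I) := by
  have h := congrFun (EisensteinSeries.E2_slash_action ModularGroup.S) τ
  rw [ModularForm.SL_slash_apply, ModularGroup.denom_S, Pi.sub_apply, Pi.smul_apply,
    EisensteinSeries.D2_S, riemannZeta_two, smul_eq_mul, zpow_neg,
    ← div_eq_mul_inv, div_eq_iff (zpow_ne_zero _ τ.ne_zero)] at h
  rw [h]
  have hpi : (π : ℂ) ≠ 0 := by exact_mod_cast Real.pi_ne_zero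
  have := τ.ne_zero
  rw [zpow_ofNat]
  field_simp
  linear_combination (-6 : ℂ) * Complex.I_sq

theorem E2_T (τ : ℍ) : E2 (ModularGroup.T • τ) = E2 τ := by
  have h := congrFun (EisensteinSeries.E2_slash_action ModularGroup.T) τ
  rw [EisensteinSeries.D2_T, ModularForm.SL_slash_apply] at h
  have hd : denom ModularGroup.T τ = 1 := by
    rw [ModularGroup.denom_apply]; simp [ModularGroup.T]
  simpa [hd] using h

/-! ### The theta constants as eta quotients -/

theorem coe_S_smul (τ : ℍ) : ((ModularGroup.S • τ : ℍ) : ℂ) = -1 / τ := by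
  rw [modular_S_smul, coe_mk, ← one_div, div_neg, neg_div]

theorem coe_T_smul (τ : ℍ) : ((ModularGroup.T • τ : ℍ) : ℂ) = τ + 1 := by
  rw [modular_T_smul, coe_vadd]; simp [add_comm]

/-- `SL(2, ℤ)`-invariant holomorphic functions of weight `k < 12` vanishing at `i∞` are zero;
invariance is expressed through the generators. -/
theorem eq_zero_of_generators {k : ℕ} (hk : k < 12) {f : ℍ → ℂ} (hf : MDiff f)
    (hS : ∀ τ : ℍ, f (ModularGroup.S • τ) = (τ : ℂ) ^ k * f τ)
    (hT : ∀ τ : ℍ, f (ModularGroup.T • τ) = f τ)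
    (h0 : Tendsto f atImInfty (𝓝 0)) (τ : ℍ) : f τ = 0 := by
  refine congrFun (eq_zero_of_levelOne (k := k) (by exact_mod_cast hk) hf ?_ ?_ h0) τ
  · ext σ
    rw [ModularForm.SL_slash_apply, hS, ModularGroup.denom_S, zpow_neg, zpow_natCast]
    field_simp [σ.ne_zero]
  · ext σ
    have hd : denom ModularGroup.T σ = 1 := by
      rw [ModularGroup.denom_apply]; simp [ModularGroup.T]
    rw [ModularForm.SL_slash_apply, hT, hd, one_zpow, mul_one]

/-- The point `τ / 2`. -/
def half (τ : ℍ) : ℍ := ⟨(τ : ℂ) / 2, by simpa using τ.im_pos⟩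

theorem coe_half (τ : ℍ) : (half τ : ℂ) = τ / 2 := rfl

theorem coe_dilate (m : ℕ+) (τ : ℍ) : (dilate m τ : ℂ) = (m : ℕ) * τ := rfl

theorem im_half (τ : ℍ) : (half τ).im = τ.im / 2 := by
  rw [← coe_im, coe_half]; simp

theorem im_dilate (m : ℕ+) (τ : ℍ) : (dilate m τ).im = (m : ℕ) * τ.im := by
  rw [← coe_im, coe_dilate]; simp

theorem dilate_dilate (m n : ℕ+) (τ : ℍ) : dilate m (dilate n τ) = dilate (m * n) τ := by
  ext; simp only [coe_dilate]; push_cast; ring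

theorem half_dilate_two (τ : ℍ) : half (dilate 2 τ) = τ := by
  ext; simp [coe_dilate, coe_half]

theorem dilate_one (τ : ℍ) : dilate 1 τ = τ := by
  ext; simp [coe_dilate]

theorem tendsto_half : Tendsto half atImInfty atImInfty := by
  rw [atImInfty, tendsto_comap_iff]
  refine Tendsto.congr (fun τ => (im_half τ).symm) ?_
  exact tendsto_comap.atTop_div_const two_pos

theorem tendsto_dilate (m : ℕ+) : Tendsto (dilate m) atImInfty atImInfty := by
  rw [atImInfty, tendsto_comap_iff]
  refine Tendsto.congr (fun τ => (im_dilate m τ).symm) ?_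
  exact tendsto_comap.const_mul_atTop (by exact_mod_cast m.pos)

theorem eta_coe_ne_zero (τ : ℍ) : eta τ ≠ 0 := eta_ne_zero τ.2

/-- The theta constant `θ₂ = 2 η(2τ)² / η(τ)`. -/
def theta2 (τ : ℍ) : ℂ := 2 * eta (dilate 2 τ) ^ 2 / eta τ

/-- The theta constant `θ₄ = η(τ/2)² / η(τ)`. -/
def theta4 (τ : ℍ) : ℂ := eta (half τ) ^ 2 / eta τ

/-- The theta constant `θ₃ = η(τ)⁵ / (η(τ/2)² η(2τ)²)`. -/
def theta3 (τ : ℍ) : ℂ := eta τ ^ 5 / (eta (half τ) ^ 2 * eta (dilate 2 τ) ^ 2)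

theorem theta2_ne_zero (τ : ℍ) : theta2 τ ≠ 0 := by
  simp [theta2, eta_coe_ne_zero]

theorem theta3_ne_zero (τ : ℍ) : theta3 τ ≠ 0 := by
  simp [theta3, eta_coe_ne_zero]

theorem theta4_ne_zero (τ : ℍ) : theta4 τ ≠ 0 := by
  simp [theta4, eta_coe_ne_zero]

/-- Since `2 · (-1/τ) = -1/(τ/2)`, the map `S` exchanges `η(2τ)` and `η(τ/2)`, and so `θ₂` and `θ₄`
up to the weight factor. -/
theorem theta2_S (τ : ℍ) : theta2 (ModularGroup.S • τ) ^ 4 = -((τ : ℂ) ^ 2 * theta4 τ ^ 4) := by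
  have h1 := eta_S_pow_four τ
  have h2 := eta_S_pow_four (half τ)
  have e1 : (dilate 2 (ModularGroup.S • τ) : ℂ) = -1 / (half τ) := by
    rw [coe_dilate, coe_S_smul, coe_half]; push_cast; field_simp
  have n1 := eta_coe_ne_zero τ
  have n2 := τ.ne_zero
  rw [theta2, theta4, e1, coe_S_smul, div_pow, h1, mul_pow, ← pow_mul, pow_mul _ 4 2, h2, coe_half]
  field_simp

theorem theta4_S (τ : ℍ) : theta4 (ModularGroup.S • τ) ^ 4 = -((τ : ℂ) ^ 2 * theta2 τ ^ 4) := by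
  have h1 := eta_S_pow_four τ
  have h2 := eta_S_pow_four (dilate 2 τ)
  have e1 : (half (ModularGroup.S • τ) : ℂ) = -1 / (dilate 2 τ) := by
    rw [coe_half, coe_S_smul, coe_dilate]; push_cast; field_simp
  have n1 := eta_coe_ne_zero τ
  have n2 := τ.ne_zero
  rw [theta2, theta4, e1, coe_S_smul, div_pow, h1, ← pow_mul, pow_mul _ 4 2, h2, coe_dilate]
  push_cast
  field_simp

/-- Determines how `θ₃⁴` transforms once `θ₂⁴`, `θ₄⁴` and `η` are known. -/
theorem theta_prod (τ : ℍ) : theta2 τ * theta3 τ * theta4 τ = 2 * eta τ ^ 3 := by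
  have n1 := eta_coe_ne_zero τ
  have n2 := eta_coe_ne_zero (half τ)
  have n3 := eta_coe_ne_zero (dilate 2 τ)
  rw [theta2, theta3, theta4]
  field_simp

theorem theta3_S (τ : ℍ) : theta3 (ModularGroup.S • τ) ^ 4 = -((τ : ℂ) ^ 2 * theta3 τ ^ 4) := by
  have h1 := congrArg (· ^ 4) (theta_prod τ)
  have h2 := congrArg (· ^ 4) (theta_prod (ModularGroup.S • τ))
  have h3 := eta_S_pow_four τ
  simp only [mul_pow, theta2_S, theta4_S, coe_S_smul] at h1 h2
  rw [← pow_mul, mul_comm 3 4, pow_mul] at h1 h2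
  rw [h3] at h2
  have n : (τ : ℂ) ^ 4 * theta2 τ ^ 4 * theta4 τ ^ 4 ≠ 0 := by
    simp [τ.ne_zero, theta2_ne_zero, theta4_ne_zero]
  apply mul_left_cancel₀ n
  linear_combination h2 + (τ : ℂ) ^ 6 * h1

theorem theta2_T (τ : ℍ) : theta2 (ModularGroup.T • τ) ^ 4 = -theta2 τ ^ 4 := by
  have e1 : (dilate 2 (ModularGroup.T • τ) : ℂ) = dilate 2 τ + 2 := by
    rw [coe_dilate, coe_dilate, coe_T_smul]; push_cast; ring
  have n1 := eta_coe_ne_zero τ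
  have hz : zeta24 ≠ 0 := Complex.exp_ne_zero _
  rw [theta2, theta2, e1, coe_T_smul, eta_add_one, eta_add_two]
  field_simp
  rw [zeta24_pow, neg_one_mul]

theorem theta4_T (τ : ℍ) : theta4 (ModularGroup.T • τ) ^ 4 = theta3 τ ^ 4 := by
  have e1 : (half (ModularGroup.T • τ) : ℂ) = half τ + 1 / 2 := by
    rw [coe_half, coe_half, coe_T_smul]; ring
  have h := eta_add_half (half τ)
  rw [show (2 : ℂ) * (half τ : ℂ) = τ by rw [coe_half]; ring,
    show (4 : ℂ) * (half τ : ℂ) = dilate 2 τ by rw [coe_half, coe_dilate]; push_cast; ring] at h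
  have n1 := eta_coe_ne_zero τ
  have n2 := eta_coe_ne_zero (half τ)
  have n3 := eta_coe_ne_zero (dilate 2 τ)
  have hz : zeta24 ≠ 0 := Complex.exp_ne_zero _
  rw [theta4, theta3, e1, coe_T_smul, eta_add_one, div_pow, div_pow, div_eq_div_iff
    (by positivity) (by positivity)]
  linear_combination eta τ ^ 0 * h

theorem theta3_T (τ : ℍ) : theta3 (ModularGroup.T • τ) ^ 4 = theta4 τ ^ 4 := by
  have h1 := congrArg (· ^ 4) (theta_prod τ)
  have h2 := congrArg (· ^ 4) (theta_prod (ModularGroup.T • τ))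
  simp only [mul_pow, theta2_T, theta4_T, coe_T_smul, eta_add_one] at h1 h2
  have n : theta2 τ ^ 4 * theta3 τ ^ 4 ≠ 0 := by
    simp [theta3_ne_zero, theta2_ne_zero]
  have hz : (zeta24 ^ 3) ^ 4 = -1 := by rw [← pow_mul]; exact zeta24_pow
  rw [hz] at h2
  apply mul_left_cancel₀ n
  linear_combination -h2 - h1

/-! ### Behaviour at `i∞` -/

theorem tendsto_eulerq {h : ℝ} (hh : 0 < h) :
    Tendsto (fun τ : ℍ => euler (qParam h τ)) atImInfty (𝓝 1) :=
  tendsto_euler.comp (tendsto_qParam hh)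

theorem tendsto_euler_half :
    Tendsto (fun τ : ℍ => euler (qParam 1 (half τ))) atImInfty (𝓝 1) :=
  (tendsto_eulerq one_pos).comp tendsto_half

theorem tendsto_euler_dilate (m : ℕ+) :
    Tendsto (fun τ : ℍ => euler (qParam 1 (dilate m τ))) atImInfty (𝓝 1) :=
  (tendsto_eulerq one_pos).comp (tendsto_dilate m)

theorem tendsto_theta4 : Tendsto theta4 atImInfty (𝓝 1) := by
  have h := (tendsto_euler_half.pow 2).div (tendsto_eulerq one_pos) one_ne_zero
  rw [one_pow, div_one] at h
  refine h.congr fun τ => ?_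
  have hq : qParam 24 (half τ) ^ 2 = qParam 24 τ := by
    rw [qParam, qParam, ← Complex.exp_nat_mul, coe_half]
    congr 1; push_cast; ring
  simp only [theta4, eta_eq_euler, mul_pow, hq, Pi.div_apply]
  rw [mul_div_mul_left _ _ (qParam_ne_zero _)]

theorem tendsto_theta2 : Tendsto theta2 atImInfty (𝓝 0) := by
  have h := ((((tendsto_qParam (h := 8) (by norm_num)).const_mul 2).mul
    ((tendsto_euler_dilate 2).pow 2)).div (tendsto_eulerq one_pos) one_ne_zero)
  rw [mul_zero, zero_mul, zero_div] at h
  refine h.congr fun τ => ?_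
  have hq : qParam 24 (dilate 2 τ) ^ 2 =
      qParam 8 τ * qParam 24 τ := by
    simp only [qParam, ← Complex.exp_nat_mul, coe_dilate, ← Complex.exp_add]
    congr 1; push_cast; ring
  have := qParam_ne_zero (h := 24) (τ : ℂ)
  simp only [theta2, eta_eq_euler, mul_pow, hq, Pi.div_apply]
  rw [← mul_div_mul_left _ _ this]
  ring

theorem tendsto_theta3 : Tendsto theta3 atImInfty (𝓝 1) := by
  have h := ((tendsto_eulerq one_pos).pow 5).div
    ((tendsto_euler_half.pow 2).mul ((tendsto_euler_dilate 2).pow 2)) (by norm_num)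
  norm_num at h
  refine h.congr fun τ => ?_
  have hq : qParam 24 (half τ) ^ 2 * qParam 24 (dilate 2 τ) ^ 2 =
      qParam 24 τ ^ 5 := by
    simp only [qParam, ← Complex.exp_nat_mul, coe_dilate, coe_half,
      ← Complex.exp_add]
    congr 1; push_cast; ring
  have := pow_ne_zero 5 (qParam_ne_zero (h := 24) (τ : ℂ))
  simp only [theta3, eta_eq_euler, mul_pow, Pi.div_apply]
  rw [← mul_div_mul_left _ _ this]
  nth_rw 2 [← hq]
  congr 1; ring

/-! ### Derivatives of the theta constants -/

theorem hasD_eta_dilate (m : ℕ+) (τ : ℍ) :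
    HasD (fun σ => eta (dilate m σ))
      (eta (dilate m τ) * ((m : ℕ) * E2 (dilate m τ) / 24)) τ :=
  (HasD.scale (φ := dilate m) (coe_dilate m) (hasD_eta _)).congr_deriv (by ring)

theorem hasD_eta_half (τ : ℍ) :
    HasD (fun σ => eta (half σ)) (eta (half τ) * (E2 (half τ) / 48)) τ :=
  (HasD.scale (c := 1 / 2) (φ := half) (fun σ => by rw [coe_half]; ring)
    (hasD_eta _)).congr_deriv (by ring)

theorem hasD_theta2_E2 (τ : ℍ) :
    HasD theta2 (theta2 τ * ((4 * E2 (dilate 2 τ) - E2 τ) / 24)) τ := by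
  have n1 := eta_coe_ne_zero τ
  refine ((((hasD_eta_dilate 2 τ).pow 2).const_mul 2).div (hasD_eta τ) n1).congr_deriv ?_
  rw [theta2]; push_cast; field_simp; ring

theorem hasD_theta4_E2 (τ : ℍ) :
    HasD theta4 (theta4 τ * ((E2 (half τ) - E2 τ) / 24)) τ := by
  have n1 := eta_coe_ne_zero τ
  refine (((hasD_eta_half τ).pow 2).div (hasD_eta τ) n1).congr_deriv ?_
  rw [theta4]; push_cast; field_simp; ring

theorem hasD_theta3_E2 (τ : ℍ) :
    HasD theta3 (theta3 τ * ((5 * E2 τ - E2 (half τ) - 4 * E2 (dilate 2 τ)) / 24)) τ := by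
  have n1 := eta_coe_ne_zero τ
  have n2 := eta_coe_ne_zero (half τ)
  have n3 := eta_coe_ne_zero (dilate 2 τ)
  refine (((hasD_eta τ).pow 5).div (((hasD_eta_half τ).pow 2).mul
    ((hasD_eta_dilate 2 τ).pow 2)) (by positivity)).congr_deriv ?_
  rw [theta3]; push_cast; field_simp; ring

/-- The difference of the two sides has weight `2` and changes sign under `T`, with an extra sign
under `S` as well. Its square is therefore a level-one form of weight `4`, and it tends to `0` at
`i∞`. -/
theorem jacobi (τ : ℍ) : theta3 τ ^ 4 = theta2 τ ^ 4 + theta4 τ ^ 4 := by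
  have hm : MDiff (fun τ => (theta2 τ ^ 4 + theta4 τ ^ 4 - theta3 τ ^ 4) ^ 2) :=
    mdiff_of_hasD fun τ => ((((hasD_theta2_E2 τ).pow 4).add ((hasD_theta4_E2 τ).pow 4)).sub
      ((hasD_theta3_E2 τ).pow 4)).pow 2
  have h0 := (((tendsto_theta2.pow 4).add (tendsto_theta4.pow 4)).sub (tendsto_theta3.pow 4)).pow 2
  norm_num at h0
  have := eq_zero_of_generators (k := 4) (by norm_num) hm
    (fun τ => by rw [theta2_S, theta3_S, theta4_S]; ring)
    (fun τ => by rw [theta2_T, theta3_T, theta4_T]; ring) h0 τ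
  linear_combination -(pow_eq_zero_iff two_ne_zero).mp this

/-! ### Logarithmic derivatives of the theta constants -/

theorem HasD.comp_T {f : ℍ → ℂ} {f' : ℂ} {τ : ℍ} (h : HasD f f' (ModularGroup.T • τ)) :
    HasD (fun σ => f (ModularGroup.T • σ)) f' τ :=
  (h.chain (ψ := fun z => z + 1) coe_T_smul ((hasDerivAt_id (τ : ℂ)).add_const 1)).congr_deriv
    (one_mul _)

theorem HasD.comp_S {f : ℍ → ℂ} {f' : ℂ} {τ : ℍ} (h : HasD f f' (ModularGroup.S • τ)) :
    HasD (fun σ => f (ModularGroup.S • σ)) (f' / (τ : ℂ) ^ 2) τ := by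
  have hd : HasDerivAt (fun z : ℂ => -1 / z) (1 / (τ : ℂ) ^ 2) τ :=
    ((hasDerivAt_const (τ : ℂ) (-1 : ℂ)).div (hasDerivAt_id (τ : ℂ)) τ.ne_zero).congr_deriv
      (by simp)
  exact (h.chain (ψ := fun z => -1 / z) coe_S_smul hd).congr_deriv (by ring)

theorem S_smul_half (τ : ℍ) : ModularGroup.S • half τ = dilate 2 (ModularGroup.S • τ) := by
  ext; rw [coe_S_smul, coe_dilate, coe_S_smul, coe_half]; push_cast; field_simp

theorem S_smul_dilate (τ : ℍ) : ModularGroup.S • dilate 2 τ = half (ModularGroup.S • τ) := by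
  ext; rw [coe_S_smul, coe_dilate, coe_half, coe_S_smul]; push_cast; field_simp

/-- Obtained by differentiating `theta4_T`, so no `q`-expansion at `(τ+1)/2` is needed. -/
theorem E2_half_T (τ : ℍ) :
    E2 (half (ModularGroup.T • τ)) = 6 * E2 τ - E2 (half τ) - 4 * E2 (dilate 2 τ) := by
  have h1 := ((hasD_theta4_E2 (ModularGroup.T • τ)).pow 4).comp_T
  have h2 := h1.congr (Eventually.of_forall fun σ => (theta4_T σ).symm)
  have h := h2.unique ((hasD_theta3_E2 τ).pow 4)
  have n : (theta3 τ) ^ 4 ≠ 0 := pow_ne_zero _ (theta3_ne_zero τ)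
  rw [E2_T] at h
  apply mul_left_cancel₀ n
  push_cast at h
  linear_combination 6 * h - (E2 (half (ModularGroup.T • τ)) - E2 τ) * theta4_T τ

theorem E2_dilate_T (τ : ℍ) : E2 (dilate 2 (ModularGroup.T • τ)) = E2 (dilate 2 τ) := by
  have : dilate 2 (ModularGroup.T • τ) = ModularGroup.T • ModularGroup.T • dilate 2 τ := by
    ext; rw [coe_T_smul, coe_T_smul, coe_dilate, coe_dilate, coe_T_smul]; push_cast; ring
  rw [this, E2_T, E2_T]

theorem deriv_jacobi (τ : ℍ) :
    theta2 τ ^ 4 * (8 * E2 (dilate 2 τ) - 6 * E2 τ + E2 (half τ)) =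
      theta4 τ ^ 4 * (6 * E2 τ - 2 * E2 (half τ) - 4 * E2 (dilate 2 τ)) := by
  have h := (((hasD_theta3_E2 τ).pow 4).congr (Eventually.of_forall fun σ => (jacobi σ).symm)).unique
    (((hasD_theta2_E2 τ).pow 4).add ((hasD_theta4_E2 τ).pow 4))
  push_cast at h
  linear_combination (5 * E2 τ - E2 (half τ) - 4 * E2 (dilate 2 τ)) * jacobi τ - 6 * h

theorem mdiff_E2 : MDiff E2 := E2_mdifferentiable

theorem hasD_E2 (τ : ℍ) : HasD E2 (Derivative.normalizedDerivOfComplex E2 τ) τ :=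
  hasD_of_mdiff mdiff_E2 τ

theorem hasD_E2_dilate (m : ℕ+) (τ : ℍ) : HasD (fun σ => E2 (dilate m σ))
    ((m : ℕ) * Derivative.normalizedDerivOfComplex E2 (dilate m τ)) τ :=
  HasD.scale (φ := dilate m) (coe_dilate m) (hasD_E2 _)

theorem hasD_E2_half (τ : ℍ) : HasD (fun σ => E2 (half σ))
    (1 / 2 * Derivative.normalizedDerivOfComplex E2 (half τ)) τ :=
  HasD.scale (φ := half) (fun σ => by rw [coe_half]; ring) (hasD_E2 _)

/-- The quotient of the two sides is holomorphic because `θ₄` has no zeros. It is invariant in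
weight `0`: the anomalies of the three `E₂` terms under `S` cancel, and what remains for both `S`
and `T` is `deriv_jacobi`. Its limit at `i∞` is `8 - 6 + 1 = 3` before normalization. -/
theorem E2_relation_theta4 (τ : ℍ) :
    8 * E2 (dilate 2 τ) - 6 * E2 τ + E2 (half τ) = 3 * theta4 τ ^ 4 := by
  have hm : MDiff (fun τ : ℍ =>
      ((8 * E2 (dilate 2 τ) - 6 * E2 τ + E2 (half τ)) / theta4 τ ^ 4 - 3 : ℂ)) :=
    mdiff_of_hasD fun τ => ((((((hasD_E2_dilate 2 τ).const_mul 8).sub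
      ((hasD_E2 τ).const_mul 6)).add (hasD_E2_half τ)).div ((hasD_theta4_E2 τ).pow 4)
      (pow_ne_zero 4 (theta4_ne_zero τ))).sub (hasD_const 3))
  have h0 := (((((tendsto_E2.comp (tendsto_dilate 2)).const_mul 8).sub
    (tendsto_E2.const_mul 6)).add (tendsto_E2.comp tendsto_half)).div (tendsto_theta4.pow 4)
    (by norm_num)).sub_const 3
  norm_num at h0
  have h := eq_zero_of_generators (k := 0) (by norm_num) hm (fun τ => ?_) (fun τ => ?_) h0 τ
  · have n := theta4_ne_zero τ
    rw [sub_eq_zero, div_eq_iff (pow_ne_zero 4 n)] at h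
    exact h
  · have n := theta4_ne_zero τ
    have n2 := theta2_ne_zero τ
    have n3 := τ.ne_zero
    have hpi : (π : ℂ) ≠ 0 := by exact_mod_cast Real.pi_ne_zero
    rw [theta4_S, ← S_smul_half, ← S_smul_dilate, E2_S, E2_S, E2_S, coe_half, coe_dilate,
      pow_zero, one_mul]
    congr 1
    rw [div_eq_div_iff (neg_ne_zero.mpr (by positivity)) (by positivity)]
    push_cast
    field_simp
    linear_combination 4 * τ * π * Complex.I * deriv_jacobi τ
  · have n := theta4_ne_zero τ
    have n2 := theta3_ne_zero τ
    rw [theta4_T, E2_half_T, E2_dilate_T, E2_T]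
    congr 1
    rw [div_eq_div_iff (by positivity) (by positivity)]
    linear_combination -deriv_jacobi τ -
      (8 * E2 (dilate 2 τ) - 6 * E2 τ + E2 (half τ)) * jacobi τ

theorem E2_relation_theta2 (τ : ℍ) :
    6 * E2 τ - 2 * E2 (half τ) - 4 * E2 (dilate 2 τ) = 3 * theta2 τ ^ 4 := by
  apply mul_left_cancel₀ (pow_ne_zero 4 (theta4_ne_zero τ))
  rw [← deriv_jacobi, E2_relation_theta4]; ring

/-- Eliminating `E₂(2τ)` and `E₂(τ/2)` leaves only `E₂(τ)` and theta constants at the same point,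
which is what closes the differential ring. -/
theorem hasD_theta2 (τ : ℍ) :
    HasD theta2 (theta2 τ * ((E2 τ + theta2 τ ^ 4 + 2 * theta4 τ ^ 4) / 24)) τ := by
  refine (hasD_theta2_E2 τ).congr_deriv ?_
  linear_combination theta2 τ / 72 * (E2_relation_theta2 τ + 2 * E2_relation_theta4 τ)

theorem hasD_theta3 (τ : ℍ) :
    HasD theta3 (theta3 τ * ((E2 τ + theta2 τ ^ 4 - theta4 τ ^ 4) / 24)) τ := by
  refine (hasD_theta3_E2 τ).congr_deriv ?_
  linear_combination theta3 τ / 72 * (E2_relation_theta2 τ - E2_relation_theta4 τ)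

/-! ### `E₄` and Ramanujan's differential equation for `E₂` -/

theorem E4_S (τ : ℍ) : ModularForm.E₄ (ModularGroup.S • τ) = (τ : ℂ) ^ 4 * ModularForm.E₄ τ := by
  have h := congrFun (SlashInvariantForm.slash_action_eqn ModularForm.E₄ _
    ⟨ModularGroup.S, rfl⟩) τ
  have h2 : ((ModularForm.E₄ : ℍ → ℂ) ∣[(4 : ℤ)] ModularGroup.S) τ = ModularForm.E₄ τ := h
  rw [ModularForm.SL_slash_apply, ModularGroup.denom_S, zpow_neg, ← div_eq_mul_inv,
    div_eq_iff (zpow_ne_zero _ τ.ne_zero)] at h2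
  rw [h2, mul_comm]; norm_cast

theorem E4_T (τ : ℍ) : ModularForm.E₄ (ModularGroup.T • τ) = ModularForm.E₄ τ := by
  have h := congrFun (SlashInvariantForm.slash_action_eqn ModularForm.E₄ _
    ⟨ModularGroup.T, rfl⟩) τ
  have h2 : ((ModularForm.E₄ : ℍ → ℂ) ∣[(4 : ℤ)] ModularGroup.T) τ = ModularForm.E₄ τ := h
  have hd : denom ModularGroup.T τ = 1 := by
    rw [ModularGroup.denom_apply]; simp [ModularGroup.T]
  rwa [ModularForm.SL_slash_apply, hd, one_zpow, mul_one] at h2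

theorem hasD_E4 (τ : ℍ) : HasD (fun τ => ModularForm.E₄ τ)
    (Derivative.normalizedDerivOfComplex ModularForm.E₄ τ) τ :=
  hasD_of_mdiff ModularForm.E₄.holo' τ

theorem E4_eq_theta (τ : ℍ) :
    ModularForm.E₄ τ = (theta2 τ ^ 8 + theta3 τ ^ 8 + theta4 τ ^ 8) / 2 := by
  have hm : MDiff (fun τ : ℍ => (2 * ModularForm.E₄ τ -
      ((theta2 τ ^ 4) ^ 2 + (theta3 τ ^ 4) ^ 2 + (theta4 τ ^ 4) ^ 2) : ℂ)) :=
    mdiff_of_hasD fun τ => ((hasD_E4 τ).const_mul 2).sub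
      (((((hasD_theta2 τ).pow 4).pow 2).add (((hasD_theta3 τ).pow 4).pow 2)).add
        (((hasD_theta4_E2 τ).pow 4).pow 2))
  have h0 := (tendsto_E4.const_mul 2).sub ((((tendsto_theta2.pow 4).pow 2).add
    ((tendsto_theta3.pow 4).pow 2)).add ((tendsto_theta4.pow 4).pow 2))
  norm_num at h0
  have h := eq_zero_of_generators (k := 4) (by norm_num) hm
    (fun τ => by rw [E4_S, theta2_S, theta3_S, theta4_S]; ring)
    (fun τ => by rw [E4_T, theta2_T, theta3_T, theta4_T]; ring) h0 τ
  linear_combination h / 2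

/-- Ramanujan's identity `D E₂ = (E₂² - E₄) / 12`. -/
theorem ramanujan_E2 (τ : ℍ) :
    Derivative.normalizedDerivOfComplex E2 τ = (E2 τ ^ 2 - ModularForm.E₄ τ) / 12 := by
  have hDE2 := Derivative.normalizedDerivOfComplex_mdifferentiable mdiff_E2
  have hm : MDiff (fun τ : ℍ => (Derivative.normalizedDerivOfComplex E2 τ -
      (1 / 12) * (E2 τ ^ 2 - ModularForm.E₄ τ) : ℂ)) :=
    mdiff_of_hasD fun τ => (hasD_of_mdiff hDE2 τ).sub
      ((((hasD_E2 τ).pow 2).sub (hasD_E4 τ)).const_mul (1 / 12))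
  have h0 := (tendsto_normalizedDeriv_zero mdiff_E2 tendsto_E2).sub
    (((tendsto_E2.pow 2).sub tendsto_E4).const_mul (1 / 12))
  norm_num at h0
  have hpi : (π : ℂ) ≠ 0 := by exact_mod_cast Real.pi_ne_zero
  have h := eq_zero_of_generators (k := 4) (by norm_num) hm (fun τ => ?_) (fun τ => ?_)
    (by simpa using h0) τ
  · linear_combination h
  · have hid : HasD (fun σ : ℍ => (σ : ℂ)) (2 * π * Complex.I)⁻¹ τ := by
      rw [HasD, mul_inv_cancel₀ Complex.two_pi_I_ne_zero]
      refine (hasDerivAt_id (τ : ℂ)).congr_of_eventuallyEq ?_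
      filter_upwards [isOpen_upperHalfPlaneSet.mem_nhds τ.im_pos] with z hz
      simp [ofComplex_apply_of_im_pos hz]
    -- Differentiating the law of `E₂` under `S` gives that of `DE₂`; its anomalous terms cancel
    -- those of `E₂²/12`.
    have e := ((hasD_E2 (ModularGroup.S • τ)).comp_S.congr
      (g := fun σ : ℍ => (σ : ℂ) ^ 2 * E2 σ + 6 / (π * Complex.I) * σ)
      (Eventually.of_forall fun σ => by rw [E2_S]; ring)).unique
      (((hid.pow 2).mul (hasD_E2 τ)).add (hid.const_mul _))
    rw [div_eq_iff (pow_ne_zero 2 τ.ne_zero)] at e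
    rw [e, E4_S, E2_S]
    have := Complex.I_ne_zero
    field_simp
    push_cast
    ring
  · have e := ((hasD_E2 (ModularGroup.T • τ)).comp_T.congr
      (g := E2) (Eventually.of_forall fun σ => by rw [E2_T])).unique (hasD_E2 τ)
    rw [e, E4_T, E2_T]

/-! ### Landen's transformation -/

theorem theta2_sq (τ : ℍ) : theta2 τ ^ 2 = 2 * theta2 (dilate 2 τ) * theta3 (dilate 2 τ) := by
  have n1 := eta_coe_ne_zero τ
  have n2 := eta_coe_ne_zero (dilate 2 τ)
  have n3 := eta_coe_ne_zero (dilate 2 (dilate 2 τ))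
  rw [theta2, theta2, theta3, half_dilate_two]
  field_simp

theorem theta3_mul_theta4 (τ : ℍ) : theta3 τ * theta4 τ = theta4 (dilate 2 τ) ^ 2 := by
  have n1 := eta_coe_ne_zero τ
  have n2 := eta_coe_ne_zero (dilate 2 τ)
  have n3 := eta_coe_ne_zero (half τ)
  rw [theta3, theta4, theta4, half_dilate_two]
  field_simp

theorem hasD_theta2_dilate (m : ℕ+) (τ : ℍ) : HasD (fun σ => theta2 (dilate m σ))
    ((m : ℕ) * (theta2 (dilate m τ) * ((E2 (dilate m τ) + theta2 (dilate m τ) ^ 4 +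
      2 * theta4 (dilate m τ) ^ 4) / 24))) τ :=
  HasD.scale (φ := dilate m) (coe_dilate m) (hasD_theta2 _)

theorem hasD_theta3_dilate (m : ℕ+) (τ : ℍ) : HasD (fun σ => theta3 (dilate m σ))
    ((m : ℕ) * (theta3 (dilate m τ) * ((E2 (dilate m τ) + theta2 (dilate m τ) ^ 4 -
      theta4 (dilate m τ) ^ 4) / 24))) τ :=
  HasD.scale (φ := dilate m) (coe_dilate m) (hasD_theta3 _)

/-- Put `p = θ₃²` and let `P`, `R` be the sum and difference of `θ₃(2τ)²` and `θ₂(2τ)²`. Jacobi at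
`τ` and `2τ` with the two product formulas gives `(p² - P²)(p² + R²) = 0`. Holomorphic functions on
`ℍ` have no zero divisors, so one factor vanishes identically, and the limits at `i∞` single out `p
= P`. -/
theorem theta3_sq (τ : ℍ) :
    theta3 τ ^ 2 = theta3 (dilate 2 τ) ^ 2 + theta2 (dilate 2 τ) ^ 2 := by
  let f : ℍ → ℂ := fun τ => theta3 τ ^ 2 - (theta3 (dilate 2 τ) ^ 2 + theta2 (dilate 2 τ) ^ 2)
  let g : ℍ → ℂ := fun τ => (theta3 τ ^ 2 + (theta3 (dilate 2 τ) ^ 2 + theta2 (dilate 2 τ) ^ 2)) *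
    ((theta3 τ ^ 2) ^ 2 + (theta3 (dilate 2 τ) ^ 2 - theta2 (dilate 2 τ) ^ 2) ^ 2)
  have hP : ∀ τ, HasD (fun τ => theta3 (dilate 2 τ) ^ 2 + theta2 (dilate 2 τ) ^ 2) _ τ := fun τ =>
    ((hasD_theta3_dilate 2 τ).pow 2).add ((hasD_theta2_dilate 2 τ).pow 2)
  have hR : ∀ τ, HasD (fun τ => theta3 (dilate 2 τ) ^ 2 - theta2 (dilate 2 τ) ^ 2) _ τ := fun τ =>
    ((hasD_theta3_dilate 2 τ).pow 2).sub ((hasD_theta2_dilate 2 τ).pow 2)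
  have hp := fun τ => (hasD_theta3 τ).pow 2
  have hf : MDiff f := mdiff_of_hasD fun τ => (hp τ).sub (hP τ)
  have hg : MDiff g := mdiff_of_hasD fun τ => ((hp τ).add (hP τ)).mul
    (((hp τ).pow 2).add ((hR τ).pow 2))
  have hfg : f * g = 0 := by
    ext σ
    have h1 := theta2_sq σ
    have h2 := theta3_mul_theta4 σ
    have h3 := jacobi σ
    have h4 := jacobi (dilate 2 σ)
    simp only [f, g, Pi.mul_apply, Pi.zero_apply]
    have e1 : theta2 σ ^ 4 = 4 * theta2 (dilate 2 σ) ^ 2 * theta3 (dilate 2 σ) ^ 2 := by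
      linear_combination (theta2 σ ^ 2 + 2 * theta2 (dilate 2 σ) * theta3 (dilate 2 σ)) * h1
    have e2 : theta3 σ ^ 4 * theta4 σ ^ 4 =
        (theta3 (dilate 2 σ) ^ 4 - theta2 (dilate 2 σ) ^ 4) ^ 2 := by
      rw [h4, ← mul_pow, h2]; ring
    linear_combination theta3 σ ^ 4 * h3 + theta3 σ ^ 4 * e1 + e2
  rcases (UpperHalfPlane.mul_eq_zero_iff hf hg).mp hfg with h | h
  · exact sub_eq_zero.mp (congrFun h τ)
  · exfalso
    have t3 := tendsto_theta3.comp (tendsto_dilate 2)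
    have t2 := tendsto_theta2.comp (tendsto_dilate 2)
    -- This limit is `(1 + 1)(1 + 1) = 4`, so `g` is not identically zero.
    have ht : Tendsto g atImInfty (𝓝 _) := ((tendsto_theta3.pow 2).add
      ((t3.pow 2).add (t2.pow 2))).mul (((tendsto_theta3.pow 2).pow 2).add
      (((t3.pow 2).sub (t2.pow 2)).pow 2))
    rw [h] at ht
    have := tendsto_nhds_unique ht (tendsto_const_nhds (x := (0 : ℂ)))
    norm_num at this

theorem theta4_sq (τ : ℍ) :
    theta4 τ ^ 2 = theta3 (dilate 2 τ) ^ 2 - theta2 (dilate 2 τ) ^ 2 := by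
  apply mul_left_cancel₀ (pow_ne_zero 2 (theta3_ne_zero τ))
  rw [← mul_pow, theta3_mul_theta4, theta3_sq, ← pow_mul]
  linear_combination -jacobi (dilate 2 τ)

/-! ### Uniformization at level eight -/

/-- `x = θ₃(4τ)²`. -/
def ux (τ : ℍ) : ℂ := theta3 (dilate 4 τ) ^ 2

/-- `z = θ₂(4τ)²`. -/
def uz (τ : ℍ) : ℂ := theta2 (dilate 4 τ) ^ 2

/-- `e = E₂(4τ)`. -/
def ue (τ : ℍ) : ℂ := E2 (dilate 4 τ)

/-- The logarithmic derivative of `t`. -/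
def us (τ : ℍ) : ℂ := ux τ ^ 2 - 2 * ux τ * uz τ - uz τ ^ 2

theorem ux_ne_zero (τ : ℍ) : ux τ ≠ 0 := pow_ne_zero _ (theta3_ne_zero _)

theorem uz_ne_zero (τ : ℍ) : uz τ ≠ 0 := pow_ne_zero _ (theta2_ne_zero _)

theorem theta3_dilate_two_sq (τ : ℍ) : theta3 (dilate 2 τ) ^ 2 = ux τ + uz τ := by
  rw [theta3_sq, dilate_dilate]; rfl

theorem theta4_dilate_two_sq (τ : ℍ) : theta4 (dilate 2 τ) ^ 2 = ux τ - uz τ := by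
  rw [theta4_sq, dilate_dilate]; rfl

theorem theta2_dilate_two_pow (τ : ℍ) : theta2 (dilate 2 τ) ^ 4 = 4 * ux τ * uz τ := by
  rw [pow_mul _ 2 2, theta2_sq, dilate_dilate, ux, uz, show (2 * 2 : ℕ+) = 4 by rfl]; ring

theorem theta4_dilate_four_pow (τ : ℍ) : theta4 (dilate 4 τ) ^ 4 = ux τ ^ 2 - uz τ ^ 2 := by
  rw [ux, uz]; linear_combination -jacobi (dilate 4 τ)

theorem ux_add_uz_ne_zero (τ : ℍ) : ux τ + uz τ ≠ 0 := by
  rw [← theta3_dilate_two_sq]; exact pow_ne_zero _ (theta3_ne_zero _)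

theorem ux_sub_uz_ne_zero (τ : ℍ) : ux τ - uz τ ≠ 0 := by
  rw [← theta4_dilate_two_sq]; exact pow_ne_zero _ (theta4_ne_zero _)

theorem half_dilate_four (τ : ℍ) : half (dilate 4 τ) = dilate 2 τ := by
  rw [show (4 : ℕ+) = 2 * 2 by rfl, ← dilate_dilate, half_dilate_two]

/-- By Landen, `x ± z` are `θ₃(2τ)²` and `θ₄(2τ)²`, so the right side is a pure eta quotient. -/
theorem t_eq (τ : ℍ) : t τ = uz τ * (ux τ - uz τ) / (4 * ux τ * (ux τ + uz τ)) := by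
  rw [← theta3_dilate_two_sq, ← theta4_dilate_two_sq, ux, uz, theta2, theta3, theta3, theta4,
    dilate_dilate, dilate_dilate, half_dilate_four, half_dilate_two, t, etaAt, etaAt, etaAt, etaAt,
    dilate_one, show (2 * 4 : ℕ+) = 8 by rfl, show (2 * 2 : ℕ+) = 4 by rfl]
  have n1 := eta_coe_ne_zero τ
  have n2 := eta_coe_ne_zero (dilate 2 τ)
  have n3 := eta_coe_ne_zero (dilate 4 τ)
  have n4 := eta_coe_ne_zero (dilate 8 τ)
  field_simp
  norm_num

theorem Y_eq (τ : ℍ) : Y τ = ux τ * (ux τ + uz τ) := by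
  rw [← theta3_dilate_two_sq, ux, theta3, theta3,
    dilate_dilate, dilate_dilate, half_dilate_four, half_dilate_two, Y, etaAt, etaAt, etaAt, etaAt,
    dilate_one, show (2 * 4 : ℕ+) = 8 by rfl, show (2 * 2 : ℕ+) = 4 by rfl]
  have n1 := eta_coe_ne_zero τ
  have n2 := eta_coe_ne_zero (dilate 2 τ)
  have n3 := eta_coe_ne_zero (dilate 4 τ)
  have n4 := eta_coe_ne_zero (dilate 8 τ)
  field_simp

theorem Y_ne_zero (τ : ℍ) : Y τ ≠ 0 := by
  rw [Y_eq]; exact mul_ne_zero (ux_ne_zero τ) (ux_add_uz_ne_zero τ)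

theorem t_ne_zero (τ : ℍ) : t τ ≠ 0 := by
  simp [t_eq, ux_ne_zero, uz_ne_zero, ux_add_uz_ne_zero, ux_sub_uz_ne_zero]

/-! ### `E₄` at `τ, 2τ, 4τ, 8τ` and `g₈` as polynomials in `ux`, `uz`. -/

theorem E4_dilate_four (τ : ℍ) :
    ModularForm.E₄ (dilate 4 τ) = ux τ ^ 4 - ux τ ^ 2 * uz τ ^ 2 + uz τ ^ 4 := by
  have h := theta4_dilate_four_pow τ
  rw [E4_eq_theta, pow_mul (theta4 _) 4 2, h, ux, uz]
  ring

theorem E4_dilate_two (τ : ℍ) :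
    ModularForm.E₄ (dilate 2 τ) = ux τ ^ 4 + 14 * ux τ ^ 2 * uz τ ^ 2 + uz τ ^ 4 := by
  rw [E4_eq_theta, pow_mul (theta4 _) 2 4, pow_mul (theta3 _) 2 4, pow_mul (theta2 _) 4 2,
    theta3_dilate_two_sq, theta4_dilate_two_sq, theta2_dilate_two_pow]
  ring

theorem E4_dilate_one (τ : ℍ) :
    ModularForm.E₄ (dilate 1 τ) =
      (ux τ + uz τ) ^ 4 + 56 * ux τ * uz τ * (ux τ + uz τ) ^ 2 + 16 * ux τ ^ 2 * uz τ ^ 2 := by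
  rw [dilate_one, E4_eq_theta, pow_mul (theta4 _) 2 4, pow_mul (theta3 _) 2 4,
    pow_mul (theta2 _) 2 4, theta2_sq, theta4_sq, theta3_sq, mul_pow, mul_pow, pow_mul _ 2 2,
    theta3_dilate_two_sq]
  have h : (theta2 (dilate 2 τ) ^ 2) ^ 2 = 4 * ux τ * uz τ := by
    rw [← theta2_dilate_two_pow]; ring
  rw [theta2_dilate_two_pow]
  have h3 : theta3 (dilate 2 τ) ^ 4 = (ux τ + uz τ) ^ 2 := by
    rw [← theta3_dilate_two_sq]; ring
  -- `b` is not a polynomial in `x, z`, but only its even powers survive in `θ₃⁸ + θ₄⁸`, and `b² =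
  -- 4xz`.
  generalize theta2 (dilate 2 τ) ^ 2 = b at h
  rw [h3]
  linear_combination (6 * (ux τ + uz τ) ^ 2 + b ^ 2 + 4 * ux τ * uz τ) * h

theorem E4_dilate_eight (τ : ℍ) :
    ModularForm.E₄ (dilate 8 τ) = ux τ ^ 4 - ux τ ^ 2 * uz τ ^ 2 + uz τ ^ 4 / 16 := by
  have h3 := theta3_sq (dilate 4 τ)
  have h4 := theta4_sq (dilate 4 τ)
  have hj := jacobi (dilate 8 τ)
  have hw := theta4_dilate_four_pow τ
  rw [dilate_dilate, show (2 * 4 : ℕ+) = 8 by rfl] at h3 h4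
  have h3' : ux τ = theta3 (dilate 8 τ) ^ 2 + theta2 (dilate 8 τ) ^ 2 := h3
  have e3 : theta3 (dilate 8 τ) ^ 2 = (ux τ + theta4 (dilate 4 τ) ^ 2) / 2 := by
    linear_combination -(h3' + h4) / 2
  have e2 : theta2 (dilate 8 τ) ^ 2 = (ux τ - theta4 (dilate 4 τ) ^ 2) / 2 := by
    linear_combination -(h3' - h4) / 2
  have e4 : theta4 (dilate 8 τ) ^ 4 = ux τ * theta4 (dilate 4 τ) ^ 2 := by
    rw [pow_mul _ 2 2, pow_mul _ 2 2, e3, e2] at hj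
    linear_combination -hj
  have hw' : (theta4 (dilate 4 τ) ^ 2) ^ 2 = ux τ ^ 2 - uz τ ^ 2 := by rw [← hw]; ring
  rw [E4_eq_theta, pow_mul (theta4 _) 4 2, pow_mul (theta3 _) 2 4, pow_mul (theta2 _) 2 4, e2, e3,
    e4]
  -- Again only even powers of the square root `w` of `x² - z²` occur.
  generalize theta4 (dilate 4 τ) ^ 2 = w at hw'
  linear_combination (7 / 8 * ux τ ^ 2 + (w ^ 2 + ux τ ^ 2 - uz τ ^ 2) / 16) * hw'

theorem g8_eq (τ : ℍ) : g8 τ = uz τ * (ux τ - uz τ) / 4 * us τ := by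
  rw [g8, E4_dilate_one, E4_dilate_two, E4_dilate_four, E4_dilate_eight, us]
  ring

theorem g8_eq_mul (τ : ℍ) : g8 τ = Y τ * (t τ * us τ) := by
  rw [g8_eq, Y_eq, t_eq]
  have := ux_ne_zero τ
  have := ux_add_uz_ne_zero τ
  field_simp

theorem quadratic_t (τ : ℍ) : Y τ ^ 2 * (1 - 24 * t τ + 16 * t τ ^ 2) = us τ ^ 2 := by
  rw [Y_eq, t_eq, us]
  have := ux_ne_zero τ
  have := ux_add_uz_ne_zero τ
  field_simp
  ring

/-! ### The differential ring -/

theorem hasD_ux (τ : ℍ) :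
    HasD ux (ux τ * (2 * uz τ ^ 2 - ux τ ^ 2 + ue τ) / 3) τ := by
  refine ((hasD_theta3_dilate 4 τ).pow 2).congr_deriv ?_
  rw [theta4_dilate_four_pow, ue, ux, uz]
  push_cast; ring

theorem hasD_uz (τ : ℍ) :
    HasD uz (uz τ * (2 * ux τ ^ 2 - uz τ ^ 2 + ue τ) / 3) τ := by
  refine ((hasD_theta2_dilate 4 τ).pow 2).congr_deriv ?_
  rw [theta4_dilate_four_pow, ue, ux, uz]
  push_cast; ring

theorem hasD_ue (τ : ℍ) :
    HasD ue ((ue τ ^ 2 - ux τ ^ 4 + ux τ ^ 2 * uz τ ^ 2 - uz τ ^ 4) / 3) τ := by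
  refine (hasD_E2_dilate 4 τ).congr_deriv ?_
  rw [ramanujan_E2, E4_dilate_four, ue]
  push_cast; ring

/-- `t` has weight `0`, so the `E₂` contributions cancel and the logarithmic derivative is a
polynomial in `x, z` alone. -/
theorem hasD_t (τ : ℍ) : HasD t (t τ * us τ) τ := by
  have := ux_ne_zero τ
  have := ux_add_uz_ne_zero τ
  refine ((((hasD_uz τ).mul ((hasD_ux τ).sub (hasD_uz τ))).div
    ((((hasD_ux τ).const_mul 4).mul ((hasD_ux τ).add (hasD_uz τ))))
    (mul_ne_zero (mul_ne_zero (by norm_num) (ux_ne_zero τ)) (ux_add_uz_ne_zero τ))).congr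
    (Eventually.of_forall t_eq)).congr_deriv ?_
  rw [t_eq, us]
  field_simp
  ring

/-- The logarithmic derivative of `Y`. -/
def uy (τ : ℍ) : ℂ := (2 * ue τ - 2 * ux τ ^ 2 + 3 * ux τ * uz τ + uz τ ^ 2) / 3

theorem hasD_Y (τ : ℍ) : HasD Y (Y τ * uy τ) τ := by
  refine (((hasD_ux τ).mul ((hasD_ux τ).add (hasD_uz τ))).congr
    (Eventually.of_forall Y_eq)).congr_deriv ?_
  rw [Y_eq, uy]
  ring

/-! ### Behaviour at `i∞` -/

theorem tendsto_ux : Tendsto ux atImInfty (𝓝 1) := by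
  simpa using! (tendsto_theta3.comp (tendsto_dilate 4)).pow 2

theorem tendsto_uz : Tendsto uz atImInfty (𝓝 0) := by
  simpa using! (tendsto_theta2.comp (tendsto_dilate 4)).pow 2

theorem tendsto_t : Tendsto t atImInfty (𝓝 0) := by
  have h := (tendsto_uz.mul (tendsto_ux.sub tendsto_uz)).div
    ((tendsto_ux.const_mul 4).mul (tendsto_ux.add tendsto_uz)) (by norm_num)
  norm_num at h
  exact h.congr fun τ => (t_eq τ).symm

theorem tendsto_Y : Tendsto Y atImInfty (𝓝 1) := by
  have h := tendsto_ux.mul (tendsto_ux.add tendsto_uz)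
  norm_num at h
  exact h.congr fun τ => (Y_eq τ).symm

/-! ### The function `Φ` -/

theorem Phi_eq (τ : ℍ) (h : 1 - 24 * t τ + 16 * t τ ^ 2 ≠ 0) : Phi τ = g8 τ := by
  have hq := quadratic_t τ
  have ht := t_ne_zero τ
  have hY := Y_ne_zero τ
  rw [Phi, (hasD_t τ).normalizedDeriv_eq, mul_div_cancel_left₀ _ ht, g8_eq_mul,
    ← mul_div_assoc, div_eq_iff (mul_ne_zero hY h)]
  linear_combination -us τ * t τ * hq

/-! ### The `q`-expansion of `g₈` -/

theorem q_dilate (m : ℕ+) (τ : ℍ) : q (dilate m τ) = q τ ^ (m : ℕ) := by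
  rw [q, q, ← Complex.exp_nat_mul, coe_dilate]; congr 1; ring

theorem hasSum_sigma3Div (m : ℕ+) (τ : ℍ) :
    HasSum (fun n : ℕ => (sigma3Div n m : ℂ) * q τ ^ n) (powerSum coeffE4 (q (dilate m τ))) := by
  have h := convergesIn_coeffE4.hasSum (norm_q_lt_one (dilate m τ))
  have hinj : Function.Injective fun n : ℕ => (m : ℕ) * n :=
    fun a b h => Nat.eq_of_mul_eq_mul_left m.pos h
  rw [← hinj.hasSum_iff]
  · convert! h using 2 with n
    simp [sigma3Div, coeffE4, q_dilate, pow_mul]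
  · intro n hn
    have : ¬ (m : ℕ) ∣ n := fun ⟨k, hk⟩ => hn ⟨k, hk.symm⟩
    simp [sigma3Div, this]

/-- The coefficients `aₙ` as complex numbers. -/
def coeffA (n : ℕ) : ℂ := (a n : ℂ)

theorem norm_sigma3Div_le (n d : ℕ) : ‖(sigma3Div n d : ℂ)‖ ≤ (n : ℝ) ^ 4 := by
  rw [sigma3Div]
  split_ifs with h
  · have h1 := norm_sigma_le 3 (n / d)
    push_cast at h1 ⊢
    refine h1.trans (pow_le_pow_left₀ (by positivity) ?_ 4)
    exact_mod_cast Nat.div_le_self n d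
  · simp only [Int.cast_zero, norm_zero]; positivity

/-- The constant is `1 + 21 + 84 + 64 = 170`. -/
theorem norm_coeffA_le (n : ℕ) : ‖coeffA n‖ ≤ 170 * (n : ℝ) ^ 4 := by
  have h1 := norm_sigma3Div_le n 1
  have h2 := norm_sigma3Div_le n 2
  have h4 := norm_sigma3Div_le n 4
  have h8 := norm_sigma3Div_le n 8
  have : coeffA n = (sigma3Div n 1 : ℂ) - 21 * (sigma3Div n 2 : ℂ) + 84 * (sigma3Div n 4 : ℂ) -
      64 * (sigma3Div n 8 : ℂ) := by rw [coeffA, a]; push_cast; ring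
  rw [this]
  refine (norm_sub_le _ _).trans ((add_le_add_left ((norm_add_le _ _).trans (add_le_add_left
    (norm_sub_le _ _) _)) _).trans ?_)
  simp only [norm_mul, Complex.norm_ofNat]
  linarith

theorem convergesIn_coeffA : ConvergesIn coeffA 1 := convergesIn_one_of_le norm_coeffA_le

theorem coeffA_zero : coeffA 0 = 0 := by
  simpa using norm_coeffA_le 0

theorem g8_eq_powerSum (τ : ℍ) : g8 τ = powerSum coeffA (q τ) := by
  have h := (((hasSum_sigma3Div 1 τ).sub ((hasSum_sigma3Div 2 τ).mul_left 21)).add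
    ((hasSum_sigma3Div 4 τ).mul_left 84)).sub ((hasSum_sigma3Div 8 τ).mul_left 64)
  have h2 := convergesIn_coeffA.hasSum (norm_q_lt_one τ)
  rw [g8, E4_eq_powerSum, E4_eq_powerSum, E4_eq_powerSum, E4_eq_powerSum]
  have e := h2.unique (h.congr_fun fun n => by
    rw [coeffA, a]; push_cast; ring)
  linear_combination -e

theorem hasSum_pnat_of_hasSum {f : ℕ → ℂ} {s : ℂ} (h : HasSum f s) (h0 : f 0 = 0) :
    HasSum (fun n : ℕ+ => f n) s := by
  refine (PNat.coe_injective.hasSum_iff (f := f) fun n hn => ?_).mpr h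
  rcases n with _ | n
  · exact h0
  · exact absurd ⟨⟨n + 1, n.succ_pos⟩, rfl⟩ hn

theorem hasSum_g8 (τ : ℍ) :
    HasSum (fun n : ℕ+ => ((a n : ℤ) : ℂ) * q τ ^ (n : ℕ)) (g8 τ) := by
  have h := hasSum_pnat_of_hasSum (convergesIn_coeffA.hasSum (norm_q_lt_one τ))
    (by simp [coeffA_zero])
  rw [← g8_eq_powerSum] at h
  exact h

/-! ### The Eichler series -/

/-- The coefficients `aₙ / n³`. -/
def coeffEichler (n : ℕ) : ℂ := coeffA n / (n : ℂ) ^ 3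

theorem coeffEichler_zero : coeffEichler 0 = 0 := by simp [coeffEichler]

theorem convergesIn_coeffEichler : ConvergesIn coeffEichler 1 := by
  refine convergesIn_coeffA.mono fun n => ?_
  rcases n with _ | n
  · simp [coeffEichler]
  · rw [coeffEichler, norm_div, norm_pow, Complex.norm_natCast]
    refine div_le_self (norm_nonneg _) (one_le_pow₀ ?_)
    exact_mod_cast Nat.succ_pos n

/-- Says that `D³` of the Eichler series is `g₈`. The index `0` causes no trouble, as `coeffA 0 =
0`. -/
theorem theta_coeffEichler :
    (fun n : ℕ => (n : ℂ) * (n * (n * coeffEichler n))) = coeffA := by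
  ext n
  rcases n with _ | n
  · simp [coeffA_zero]
  · have : ((n + 1 : ℕ) : ℂ) ≠ 0 := Nat.cast_ne_zero.mpr n.succ_ne_zero
    rw [coeffEichler]; field_simp

theorem hasSum_eichlerTerm (τ : ℍ) :
    HasSum (eichlerTerm a τ) (powerSum coeffEichler (q τ)) :=
  hasSum_pnat_of_hasSum (convergesIn_coeffEichler.hasSum (norm_q_lt_one τ))
    (by simp [coeffEichler_zero])

theorem eichlerSeries_eq (τ : ℍ) : eichlerSeries a τ = powerSum coeffEichler (q τ) :=
  (hasSum_eichlerTerm τ).tsum_eq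

theorem mdiff_eichlerSeries : MDiff (eichlerSeries a) :=
  mdiff_of_hasD fun τ => (hasD_qSeries convergesIn_coeffEichler τ).congr
    (Eventually.of_forall eichlerSeries_eq)

/-! ### The companion power series -/

/-- The coefficients `Bₙ` as complex numbers. -/
def coeffB (n : ℕ) : ℂ := ((B n : ℚ) : ℂ)

/-- The recurrence is dominated by `24 |Bₙ₊₁| + 16 |Bₙ|`, and `24 · 25 + 16 = 616 ≤ 25²`. Any
positive radius of convergence would suffice near `i∞`. -/
theorem abs_B_le (n : ℕ) : |B n| ≤ 25 ^ n := by
  induction n using Nat.twoStepInduction with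
  | zero => simp [B]
  | one => norm_num [B]
  | more n h0 h1 =>
    have hn : (0 : ℚ) ≤ n := n.cast_nonneg
    rw [B, abs_div, abs_of_pos (show (0 : ℚ) < (n + 2) ^ 3 by positivity),
      div_le_iff₀ (by positivity)]
    refine (abs_sub _ _).trans ?_
    rw [abs_mul, abs_mul _ (B n), abs_of_nonneg (by positivity),
      abs_of_nonneg (a := 16 * _) (by positivity)]
    have e1 : (2 * ((n : ℚ) + 1) + 1) * (12 * ((n : ℚ) + 1) ^ 2 + 12 * ((n : ℚ) + 1) + 4) ≤
        24 * (n + 2) ^ 3 := by nlinarith [sq_nonneg (n : ℚ)]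
    have e2 : 16 * ((n : ℚ) + 1) ^ 3 ≤ 16 * (n + 2) ^ 3 := by gcongr; norm_num
    calc _ ≤ 24 * ((n : ℚ) + 2) ^ 3 * 25 ^ (n + 1) + 16 * (n + 2) ^ 3 * 25 ^ n :=
          add_le_add (mul_le_mul e1 h1 (abs_nonneg _) (by positivity))
            (mul_le_mul e2 h0 (abs_nonneg _) (by positivity))
      _ ≤ 25 ^ (n + 2) * ((n : ℚ) + 2) ^ 3 := by
        have : 0 ≤ ((n : ℚ) + 2) ^ 3 * 25 ^ n := by positivity
        rw [pow_add 25 n 2, pow_succ 25 n]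
        linarith

theorem convergesIn_coeffB : ConvergesIn coeffB (1 / 25) := by
  intro r h0 hr
  have hg := summable_geometric_of_lt_one (r := 25 * r) (by positivity) (by linarith)
  refine hg.of_nonneg_of_le (fun n => by positivity) fun n => ?_
  rw [mul_pow]
  refine mul_le_mul_of_nonneg_right ?_ (pow_nonneg h0 n)
  rw [coeffB, Complex.norm_ratCast]
  exact_mod_cast abs_B_le n

/-- The coefficients `nᵏ Bₙ`. -/
def coeffBk (k n : ℕ) : ℂ := (n : ℂ) ^ k * coeffB n

theorem coeffBk_succ (k : ℕ) : (fun n : ℕ => (n : ℂ) * coeffBk k n) = coeffBk (k + 1) := by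
  ext n; rw [coeffBk, coeffBk]; ring

theorem coeffBk_zero (k : ℕ) : coeffBk k 0 = 0 := by simp [coeffBk, coeffB, B]

theorem convergesIn_coeffBk (k : ℕ) : ConvergesIn (coeffBk k) (1 / 25) := by
  induction k with
  | zero => simpa [show coeffBk 0 = coeffB by ext n; simp [coeffBk]] using convergesIn_coeffB
  | succ k ih => rw [← coeffBk_succ]; exact ih.theta

/-- The third-order differential equation of the companion series, in terms of `θ = w d/dw`. -/
theorem companion_ode {w : ℂ} (hw : ‖w‖ < 1 / 25) :
    powerSum (coeffBk 3) w -
      w * (24 * powerSum (coeffBk 3) w + 36 * powerSum (coeffBk 2) w +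
        20 * powerSum (coeffBk 1) w + 4 * powerSum (coeffBk 0) w) +
      16 * w ^ 2 * (powerSum (coeffBk 3) w + 3 * powerSum (coeffBk 2) w +
        3 * powerSum (coeffBk 1) w + powerSum (coeffBk 0) w) = w := by
  have h := fun k => (convergesIn_coeffBk k).hasSum hw
  have h1 : HasSum (fun n : ℕ => coeffBk 3 (n + 1) * w ^ (n + 1)) (powerSum (coeffBk 3) w) := by
    simpa [coeffBk_zero] using (hasSum_nat_add_iff' 1).mpr (h 3)
  have h2 := (((((h 3).mul_left 24).add ((h 2).mul_left 36)).add ((h 1).mul_left 20)).add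
    ((h 0).mul_left 4)).mul_left w
  -- The term `16w²(θ+1)³` shifted to the index of the recurrence; at `n = 0` the truncated `n - 1`
  -- is harmless because of the factor `n³`.
  have h3 : HasSum (fun n : ℕ => 16 * (n : ℂ) ^ 3 * coeffB (n - 1) * w ^ (n + 1))
      (16 * w ^ 2 * (powerSum (coeffBk 3) w + 3 * powerSum (coeffBk 2) w +
        3 * powerSum (coeffBk 1) w + powerSum (coeffBk 0) w)) := by
    have h4 := ((((h 3).add ((h 2).mul_left 3)).add ((h 1).mul_left 3)).add
      (h 0)).mul_left (16 * w ^ 2)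
    rw [← hasSum_nat_add_iff' 1]
    simp only [Finset.range_one, Finset.sum_singleton]
    convert! h4 using 1
    · ext n
      simp only [coeffBk, Nat.add_sub_cancel]; push_cast; ring
    · simp
  -- The recurrence kills every coefficient with `n ≥ 1`. It fails at `n = 0`, where `B₁ - 4B₀ = 1`
  -- leaves the inhomogeneous term `w`.
  have h5 := ((h1.sub h2).add h3).unique (hasSum_single 0 fun n hn => ?_)
  · rw [h5]; simp [coeffBk, coeffB, B]
  · have hB := B_recurrence n (Nat.one_le_iff_ne_zero.mpr hn)
    have hB' := congrArg (fun x : ℚ => (x : ℂ)) hB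
    push_cast at hB'
    simp only [coeffBk, coeffB]
    push_cast
    linear_combination w ^ (n + 1) * hB'

/-! ### The companion series as a solution of `D³ f = g₈` -/

/-- `∑ nᵏ Bₙ t(τ)ⁿ`. -/
def comp (k : ℕ) (τ : ℍ) : ℂ := powerSum (coeffBk k) (t τ)

/-- The derivative of `us`. -/
def usD (τ : ℍ) : ℂ :=
  2 * (ux τ - uz τ) * (ux τ * (2 * uz τ ^ 2 - ux τ ^ 2 + ue τ) / 3) -
    2 * (ux τ + uz τ) * (uz τ * (2 * ux τ ^ 2 - uz τ ^ 2 + ue τ) / 3)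

/-- The derivative of `uy`. -/
def uyD (τ : ℍ) : ℂ :=
  (2 * ((ue τ ^ 2 - ux τ ^ 4 + ux τ ^ 2 * uz τ ^ 2 - uz τ ^ 4) / 3) +
    (3 * uz τ - 4 * ux τ) * (ux τ * (2 * uz τ ^ 2 - ux τ ^ 2 + ue τ) / 3) +
    (3 * ux τ + 2 * uz τ) * (uz τ * (2 * ux τ ^ 2 - uz τ ^ 2 + ue τ) / 3)) / 3

theorem hasD_us (τ : ℍ) : HasD us (usD τ) τ := by
  refine ((((hasD_ux τ).pow 2).sub (((hasD_ux τ).const_mul 2).mul (hasD_uz τ))).sub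
    ((hasD_uz τ).pow 2)).congr_deriv ?_
  rw [usD]; push_cast; ring

theorem hasD_uy (τ : ℍ) : HasD uy (uyD τ) τ := by
  have h := ((((hasD_ue τ).const_mul 2).sub (((hasD_ux τ).pow 2).const_mul 2)).add
    (((hasD_ux τ).const_mul 3).mul (hasD_uz τ))).add ((hasD_uz τ).pow 2)
  refine ((h.const_mul (1 / 3)).congr (Eventually.of_forall fun σ => ?_)).congr_deriv ?_
  · rw [uy]; ring
  · rw [uyD]; push_cast; ring

theorem hasD_comp (k : ℕ) (hτ : ‖t τ‖ < 1 / 25) : HasD (comp k) (us τ * comp (k + 1) τ) τ := by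
  have h := (convergesIn_coeffBk k).hasD hτ (hasD_t τ)
  rw [coeffBk_succ] at h
  exact h

/-- The companion function `(∑ Bₙ tⁿ) / Y`. -/
def compF (τ : ℍ) : ℂ := comp 0 τ / Y τ

/-- The first derivative of `compF`. -/
def compF1 (τ : ℍ) : ℂ := (us τ * comp 1 τ - uy τ * comp 0 τ) / Y τ

/-- The second derivative of `compF`. -/
def compF2 (τ : ℍ) : ℂ :=
  (us τ ^ 2 * comp 2 τ + (usD τ - 2 * uy τ * us τ) * comp 1 τ +
    (uy τ ^ 2 - uyD τ) * comp 0 τ) / Y τ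

theorem hasD_compF (hτ : ‖t τ‖ < 1 / 25) : HasD compF (compF1 τ) τ := by
  have hY := Y_ne_zero τ
  refine ((hasD_comp 0 hτ).div (hasD_Y τ) hY).congr_deriv ?_
  rw [compF1]; field_simp

theorem hasD_compF1 (hτ : ‖t τ‖ < 1 / 25) : HasD compF1 (compF2 τ) τ := by
  have hY := Y_ne_zero τ
  refine ((((hasD_us τ).mul (hasD_comp 1 hτ)).sub ((hasD_uy τ).mul (hasD_comp 0 hτ))).div
    (hasD_Y τ) hY).congr_deriv ?_
  rw [compF2]; field_simp; ring

theorem Y_sq_mul_t (τ : ℍ) :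
    Y τ ^ 2 * t τ = ux τ * (ux τ + uz τ) * uz τ * (ux τ - uz τ) / 4 := by
  rw [Y_eq, t_eq]
  have := ux_ne_zero τ
  have := ux_add_uz_ne_zero τ
  field_simp

theorem Y_sq_mul_t_sq (τ : ℍ) :
    Y τ ^ 2 * t τ ^ 2 = uz τ ^ 2 * (ux τ - uz τ) ^ 2 / 16 := by
  rw [Y_eq, t_eq]
  have := ux_ne_zero τ
  have := ux_add_uz_ne_zero τ
  field_simp
  norm_num

/-- This is `D³(f/Y) = g₈` for the companion series `f`. After clearing `Y`, both sides are linear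
in the sums `∑ nᵏ Bₙ tⁿ` for `k ≤ 3`, with coefficients polynomial in `x, z, e`, and they match
through the differential equation. -/
theorem hasD_compF2 (hτ : ‖t τ‖ < 1 / 25) : HasD compF2 (g8 τ) τ := by
  have hY := Y_ne_zero τ
  have hx := hasD_ux τ
  have hz := hasD_uz τ
  have he := hasD_ue τ
  have hsD : HasD usD _ τ :=
    ((((hx.sub hz).const_mul 2).mul ((hx.mul ((((hz.pow 2).const_mul 2).sub (hx.pow 2)).add
      he)).const_mul (1 / 3))).sub (((hx.add hz).const_mul 2).mul ((hz.mul ((((hx.pow 2).const_mul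
      2).sub (hz.pow 2)).add he)).const_mul (1 / 3)))).congr
      (Eventually.of_forall fun σ => by rw [usD]; ring)
  have hyD : HasD uyD _ τ :=
    (((((((he.pow 2).sub (hx.pow 4)).add ((hx.pow 2).mul (hz.pow 2))).sub (hz.pow 4)).const_mul
      (2 / 3)).add (((hz.const_mul 3).sub (hx.const_mul 4)).mul ((hx.mul ((((hz.pow 2).const_mul
      2).sub (hx.pow 2)).add he)).const_mul (1 / 3)))).add (((hx.const_mul 3).add
      (hz.const_mul 2)).mul ((hz.mul ((((hx.pow 2).const_mul
      2).sub (hz.pow 2)).add he)).const_mul (1 / 3))) |>.const_mul (1 / 3)).congr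
      (Eventually.of_forall fun σ => by rw [uyD]; ring)
  have hs := hasD_us τ
  have hy := hasD_uy τ
  refine ((((((hs.pow 2).mul (hasD_comp 2 hτ)).add
    ((hsD.sub ((hy.const_mul 2).mul hs)).mul (hasD_comp 1 hτ))).add
    (((hy.pow 2).sub hyD).mul (hasD_comp 0 hτ))).div (hasD_Y τ) hY)).congr_deriv ?_
  have ode := companion_ode hτ
  have h0 := quadratic_t τ
  have h1 := Y_sq_mul_t τ
  have h2 := Y_sq_mul_t_sq τ
  rw [g8_eq_mul, div_eq_iff (pow_ne_zero 2 hY)]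
  simp only [comp] at *
  generalize powerSum (coeffBk 3) (t τ) = g3 at *
  generalize powerSum (coeffBk 2) (t τ) = g2 at *
  generalize powerSum (coeffBk 1) (t τ) = g1 at *
  generalize powerSum (coeffBk 0) (t τ) = g0 at *
  generalize t τ = T at *
  generalize Y τ = V at *
  -- The differential equation times `s Y²`; `quadratic_t` collapses its leading coefficient to
  -- `s³`, the one that `D³` produces.
  have key : V ^ 2 * T * us τ = us τ ^ 3 * g3 - us τ * (V ^ 2 * T) * (36 * g2 + 20 * g1 + 4 * g0) +
      16 * us τ * (V ^ 2 * T ^ 2) * (3 * g2 + 3 * g1 + g0) := by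
    linear_combination -us τ * V ^ 2 * ode + us τ * g3 * h0
  rw [h1, h2] at key
  have key2 : V * (T * us τ) * V ^ 2 = V * (us τ * (V ^ 2 * T)) := by ring
  rw [key2, h1]
  simp only [usD, uyD, us, uy] at key ⊢
  push_cast
  linear_combination -V * key

/-! ### Functions with vanishing derivative near `i∞` -/

/-- A function with zero derivative on a half-plane that vanishes at `i∞` is zero there. -/
theorem eq_zero_of_hasD_zero {f : ℍ → ℂ} {c : ℝ} (hf : ∀ τ : ℍ, c < τ.im → HasD f 0 τ)
    (h0 : Tendsto f atImInfty (𝓝 0)) {τ : ℍ} (hτ : c < τ.im) : f τ = 0 := by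
  have hconst : ∀ σ : ℍ, c < σ.im → f σ = f τ := by
    intro σ hσ
    have hconv : Convex ℝ {z : ℂ | max c 0 < z.im} := convex_halfSpace_im_gt _
    have hmem : ∀ ρ : ℍ, c < ρ.im → (ρ : ℂ) ∈ {z : ℂ | max c 0 < z.im} := fun ρ hρ =>
      max_lt hρ ρ.im_pos
    have := hconv.norm_image_sub_le_of_norm_hasDerivWithin_le (f := f ∘ ofComplex)
      (f' := fun _ => 0) (C := 0) (fun z hz => ?_) (by simp) (hmem τ hτ) (hmem σ hσ)
    · simpa [sub_eq_zero] using this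
    · have hz0 : 0 < z.im := (le_max_right c 0).trans_lt hz
      have h := hf ⟨z, hz0⟩ ((le_max_left c 0).trans_lt hz)
      rw [HasD, mul_zero] at h
      exact h.hasDerivWithinAt
  refine tendsto_nhds_unique (tendsto_const_nhds.congr' ?_) h0
  filter_upwards [(atImInfty_mem {σ : ℍ | c < σ.im}).mpr ⟨c + 1, fun σ hσ => by
    change c < σ.im; linarith⟩] with σ hσ
  exact (hconst σ hσ).symm

theorem tendsto_ue : Tendsto ue atImInfty (𝓝 1) := tendsto_E2.comp (tendsto_dilate 4)

theorem tendsto_us : Tendsto us atImInfty (𝓝 1) := by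
  simpa using! ((tendsto_ux.pow 2).sub ((tendsto_ux.const_mul 2).mul tendsto_uz)).sub
    (tendsto_uz.pow 2)

theorem tendsto_uy : Tendsto uy atImInfty (𝓝 0) := by
  have := ((((tendsto_ue.const_mul 2).sub ((tendsto_ux.pow 2).const_mul 2)).add
    ((tendsto_ux.const_mul 3).mul tendsto_uz)).add (tendsto_uz.pow 2)).div_const 3
  norm_num at this
  exact this.congr fun τ => by rw [uy]

theorem tendsto_comp (k : ℕ) : Tendsto (comp k) atImInfty (𝓝 0) := by
  have := tendsto_powerSum (by norm_num) (convergesIn_coeffBk k) tendsto_t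
  rwa [coeffBk_zero] at this

theorem mdiff_us : MDiff us := mdiff_of_hasD hasD_us

theorem mdiff_uy : MDiff uy := mdiff_of_hasD hasD_uy

theorem tendsto_usD : Tendsto usD atImInfty (𝓝 0) := by
  simpa only [(funext fun τ => (hasD_us τ).normalizedDeriv_eq :
    Derivative.normalizedDerivOfComplex us = usD)] using
    tendsto_normalizedDeriv_zero mdiff_us tendsto_us

theorem tendsto_uyD : Tendsto uyD atImInfty (𝓝 0) := by
  simpa only [(funext fun τ => (hasD_uy τ).normalizedDeriv_eq :
    Derivative.normalizedDerivOfComplex uy = uyD)] using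
    tendsto_normalizedDeriv_zero mdiff_uy tendsto_uy

theorem tendsto_compF : Tendsto compF atImInfty (𝓝 0) := by
  simpa using! (tendsto_comp 0).div tendsto_Y one_ne_zero

theorem tendsto_compF1 : Tendsto compF1 atImInfty (𝓝 0) := by
  simpa using! ((tendsto_us.mul (tendsto_comp 1)).sub (tendsto_uy.mul (tendsto_comp 0))).div
    tendsto_Y one_ne_zero

theorem tendsto_compF2 : Tendsto compF2 atImInfty (𝓝 0) := by
  simpa using! ((((tendsto_us.pow 2).mul (tendsto_comp 2)).add
    ((tendsto_usD.sub ((tendsto_uy.const_mul 2).mul tendsto_us)).mul (tendsto_comp 1))).add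
    (((tendsto_uy.pow 2).sub tendsto_uyD).mul (tendsto_comp 0))).div tendsto_Y one_ne_zero

/-- There is a half-plane on which `‖t‖ < 1/25`. -/
theorem exists_norm_t_lt : ∃ c : ℝ, ∀ τ : ℍ, c < τ.im → ‖t τ‖ < 1 / 25 := by
  have h := tendsto_t.eventually (Metric.ball_mem_nhds 0 (by norm_num : (0 : ℝ) < 1 / 25))
  obtain ⟨c, hc⟩ := (atImInfty_mem _).mp h
  exact ⟨c, fun τ hτ => by simpa using hc τ hτ.le⟩

/-- Near `i∞` the companion function is the Eichler series. -/
theorem compF_eq_eichlerSeries {c : ℝ} (hc : ∀ τ : ℍ, c < τ.im → ‖t τ‖ < 1 / 25)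
    {τ : ℍ} (hτ : c < τ.im) : compF τ = eichlerSeries a τ := by
  let d1 : ℕ → ℂ := fun n => n * coeffEichler n
  let d2 : ℕ → ℂ := fun n => n * d1 n
  have c1 : ConvergesIn d1 1 := convergesIn_coeffEichler.theta
  have c2 : ConvergesIn d2 1 := c1.theta
  -- Three integrations from `i∞`: each difference has zero derivative by the previous step and
  -- limit `0`, so no constant of integration appears.
  have e2 : ∀ τ : ℍ, c < τ.im → compF2 τ - powerSum d2 (q τ) = 0 := fun τ hτ =>
    eq_zero_of_hasD_zero (f := fun τ => compF2 τ - powerSum d2 (q τ)) (fun τ hτ =>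
      ((hasD_compF2 (hc τ hτ)).sub (hasD_qSeries c2 τ)).congr_deriv (by
        rw [theta_coeffEichler, g8_eq_powerSum, sub_self]))
      (by simpa [d2] using! tendsto_compF2.sub (tendsto_qSeries c2)) hτ
  have e1 : ∀ τ : ℍ, c < τ.im → compF1 τ - powerSum d1 (q τ) = 0 := fun τ hτ =>
    eq_zero_of_hasD_zero (f := fun τ => compF1 τ - powerSum d1 (q τ)) (fun τ hτ =>
      ((hasD_compF1 (hc τ hτ)).sub (hasD_qSeries c1 τ)).congr_deriv (e2 τ hτ))
      (by simpa [d1] using! tendsto_compF1.sub (tendsto_qSeries c1)) hτ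
  have e0 : compF τ - powerSum coeffEichler (q τ) = 0 :=
    eq_zero_of_hasD_zero (f := fun τ => compF τ - powerSum coeffEichler (q τ)) (fun τ hτ =>
      ((hasD_compF (hc τ hτ)).sub (hasD_qSeries convergesIn_coeffEichler τ)).congr_deriv (e1 τ hτ))
      (by simpa [coeffEichler_zero] using!
        tendsto_compF.sub (tendsto_qSeries convergesIn_coeffEichler)) hτ
  rw [eichlerSeries_eq]
  exact sub_eq_zero.mp e0

/-! ### Removable singularities of `Φ` -/

theorem mdiff_t : MDiff t := mdiff_of_hasD hasD_t

theorem mdiff_Y : MDiff Y := mdiff_of_hasD hasD_Y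

theorem mdiff_g8 : MDiff g8 := mdiff_of_hasD fun τ =>
  (hasD_qSeries convergesIn_coeffA τ).congr (Eventually.of_forall g8_eq_powerSum)

/-- The denominator `1 - 24t + 16t²` tends to `1` at `i∞`, so its zeros are isolated, and `g₈` is
continuous. -/
theorem tendsto_Phi (τ : ℍ) : Tendsto Phi (𝓝[≠] τ) (𝓝 (g8 τ)) := by
  let p : ℍ → ℂ := fun τ => 1 - 24 * t τ + 16 * t τ ^ 2
  have hp : MDiff p := mdiff_of_hasD fun τ =>
    ((hasD_const 1).sub ((hasD_t τ).const_mul 24)).add (((hasD_t τ).pow 2).const_mul 16)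
  have hne : ∀ᶠ σ in 𝓝[≠] τ, p σ ≠ 0 := by
    by_contra h
    have h0 : p = 0 := UpperHalfPlane.eq_zero_of_frequently hp h
    have ht : Tendsto p atImInfty (𝓝 _) :=
      ((tendsto_t.const_mul 24).const_sub 1).add ((tendsto_t.pow 2).const_mul 16)
    rw [h0] at ht
    have := tendsto_nhds_unique ht (tendsto_const_nhds (x := (0 : ℂ)))
    norm_num at this
  have hc : Tendsto g8 (𝓝[≠] τ) (𝓝 (g8 τ)) :=
    mdiff_g8.continuous.continuousAt.tendsto.mono_left nhdsWithin_le_nhds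
  exact hc.congr' (hne.mono fun σ hσ => (Phi_eq σ hσ).symm)

/-! ### Analytic continuation -/

theorem analyticAt_of_mdiff {f : ℍ → ℂ} (hf : MDiff f) (τ : ℍ) :
    AnalyticAt ℂ (f ∘ ofComplex) τ :=
  (UpperHalfPlane.mdifferentiable_iff.mp hf).analyticAt
    (isOpen_upperHalfPlaneSet.mem_nhds τ.im_pos)

/-- The function `t` is open at every point. -/
theorem nhds_le_map_t (τ : ℍ) : 𝓝 (t τ) ≤ map (t ∘ ofComplex) (𝓝 (τ : ℂ)) := by
  have h := (analyticAt_of_mdiff mdiff_t τ).eventually_constant_or_nhds_le_map_nhds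
  rw [Function.comp_apply, ofComplex_apply] at h
  refine h.resolve_left fun hconst => ?_
  -- If `t` were locally constant it would be constant, hence equal to its limit `0` at `i∞`; but
  -- `t` never vanishes.
  have h1 : ∀ᶠ σ in 𝓝 τ, t σ - t τ = 0 := by
    have := UpperHalfPlane.continuous_coe.continuousAt.tendsto.eventually hconst
    filter_upwards [this] with σ hσ
    rw [sub_eq_zero, ← hσ, Function.comp_apply, ofComplex_apply]
  have h2 := UpperHalfPlane.eq_zero_of_frequently (f := fun σ => t σ - t τ)
    (mdiff_of_hasD fun σ => (hasD_t σ).sub (hasD_const _))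
    (h1.filter_mono nhdsWithin_le_nhds).frequently
  have h3 : Tendsto t atImInfty (𝓝 (t τ)) :=
    tendsto_const_nhds.congr fun σ => (sub_eq_zero.mp (congrFun h2 σ)).symm
  exact t_ne_zero τ (tendsto_nhds_unique h3 tendsto_t)

theorem companionE_eq (τ : ℍ) : companionE τ = powerSum coeffB (t τ) / Y τ := rfl

theorem compF_eq_companionE : compF = companionE := by
  ext τ
  rw [compF, comp, companionE_eq, show coeffBk 0 = coeffB by ext n; simp [coeffBk]]

/-- On an open set of absolute convergence, `t` takes values in the interior of the disc of
convergence. -/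
theorem exists_convergesIn {U : Set ℍ} (hU : IsOpen U) (hs : ∀ τ ∈ U, Summable (companionTerm τ))
    {τ : ℍ} (hτ : τ ∈ U) : ∃ R, ‖t τ‖ < R ∧ ConvergesIn coeffB R := by
  have hUn : ∀ᶠ z in 𝓝 (τ : ℂ), ofComplex z ∈ U :=
    eventually_coe_of_eventually (hU.mem_nhds hτ)
  have himg : ∀ᶠ w in 𝓝 (t τ), ∃ σ ∈ U, t σ = w := by
    refine nhds_le_map_t τ ?_
    rw [mem_map]
    filter_upwards [hUn] with z hz
    exact ⟨ofComplex z, hz, rfl⟩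
  -- By openness `t` takes a value `(1 + ε) t(τ)` on `U` with `ε > 0`. Convergence at this strictly
  -- larger modulus puts `t(τ)` inside the disc.
  have hcurve : Tendsto (fun ε : ℝ => ((1 + ε : ℝ) : ℂ) * t τ) (𝓝[>] 0) (𝓝 (t τ)) := by
    have : ContinuousAt (fun ε : ℝ => ((1 + ε : ℝ) : ℂ) * t τ) 0 := by fun_prop
    rw [ContinuousAt] at this
    simp only [add_zero, Complex.ofReal_one, one_mul] at this
    exact this.mono_left nhdsWithin_le_nhds
  obtain ⟨ε, ⟨σ, hσ, hw⟩, hε⟩ := ((hcurve.eventually himg).and self_mem_nhdsWithin).exists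
  have hε' : (0 : ℝ) < ε := hε
  refine ⟨‖t σ‖, ?_, convergesIn_of_summable (hs σ hσ)⟩
  rw [hw, norm_mul, Complex.norm_real, Real.norm_of_nonneg (by positivity)]
  have := norm_pos_iff.mpr (t_ne_zero τ)
  nlinarith

theorem analyticAt_companionE {R : ℝ} (hc : ConvergesIn coeffB R) {τ : ℍ} (hτ : ‖t τ‖ < R) :
    AnalyticAt ℂ (companionE ∘ ofComplex) τ := by
  have h1 : AnalyticAt ℂ (powerSum coeffB) ((t ∘ ofComplex) (τ : ℂ)) :=
    hc.analyticAt (by simpa using hτ)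
  exact (h1.comp (analyticAt_of_mdiff mdiff_t τ)).div (analyticAt_of_mdiff mdiff_Y τ)
    (by simpa using Y_ne_zero τ)

theorem eventually_eq_of_halfPlane {f g : ℍ → ℂ} {c : ℝ} (h : ∀ τ : ℍ, c < τ.im → f τ = g τ)
    {τ : ℍ} (hτ : c < τ.im) : f ∘ ofComplex =ᶠ[𝓝 (τ : ℂ)] g ∘ ofComplex :=
  eventually_coe_of_eventually (p := fun σ => f σ = g σ)
    (by
      filter_upwards [(isOpen_lt continuous_const continuous_im).mem_nhds hτ] with σ hσ
      exact h σ hσ)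

/-- The identity theorem for functions on a connected set that contains a half-plane. -/
theorem eq_of_analytic_of_halfPlane {f g : ℍ → ℂ} {U : Set ℍ} (hU : IsPreconnected U)
    (hf : ∀ τ ∈ U, AnalyticAt ℂ (f ∘ ofComplex) τ) (hg : ∀ τ ∈ U, AnalyticAt ℂ (g ∘ ofComplex) τ)
    (hUc : ContainsHalfPlane U) {c : ℝ} (h : ∀ τ : ℍ, c < τ.im → f τ = g τ) {τ : ℍ}
    (hτ : τ ∈ U) : f τ = g τ := by
  obtain ⟨c', hc'⟩ := hUc
  let σ : ℍ := ⟨((max (max c c') 0 + 1 : ℝ) : ℂ) * Complex.I, by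
    simp only [Complex.mul_I_im, Complex.ofReal_re]; positivity⟩
  have hσ : σ.im = max (max c c') 0 + 1 := by
    rw [← coe_im]; simp [σ]
  have hmax : max c c' < σ.im := by
    rw [hσ]; exact (le_max_left _ _).trans_lt (lt_add_one _)
  have key := AnalyticOnNhd.eqOn_of_preconnected_of_eventuallyEq (𝕜 := ℂ)
    (f := f ∘ ofComplex) (g := g ∘ ofComplex) (U := UpperHalfPlane.coe '' U) (z₀ := σ)
    (by rintro _ ⟨ρ, hρ, rfl⟩; exact hf ρ hρ) (by rintro _ ⟨ρ, hρ, rfl⟩; exact hg ρ hρ)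
    (hU.image _ UpperHalfPlane.continuous_coe.continuousOn)
    ⟨σ, hc' σ ((le_max_right _ _).trans_lt hmax), rfl⟩
    (eventually_eq_of_halfPlane h ((le_max_left _ _).trans_lt hmax)) ⟨τ, hτ, rfl⟩
  simpa using key

theorem exists_companionE_eq :
    ∃ c : ℝ, ∀ τ : ℍ, c < τ.im → companionE τ = eichlerSeries a τ := by
  obtain ⟨c, hc⟩ := exists_norm_t_lt
  exact ⟨c, fun τ hτ => by rw [← compF_eq_companionE, compF_eq_eichlerSeries hc hτ]⟩

theorem companionE_eq_eichlerSeries {U : Set ℍ} (hU : IsOpen U) (hconn : IsConnected U)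
    (hUc : ContainsHalfPlane U) (hs : ∀ τ ∈ U, Summable (companionTerm τ)) {τ : ℍ} (hτ : τ ∈ U) :
    companionE τ = eichlerSeries a τ := by
  obtain ⟨c, hc⟩ := exists_companionE_eq
  refine eq_of_analytic_of_halfPlane hconn.isPreconnected (fun σ hσ => ?_)
    (fun σ _ => analyticAt_of_mdiff mdiff_eichlerSeries σ) hUc hc hτ
  obtain ⟨R, hR, hconv⟩ := exists_convergesIn hU hs hσ
  exact analyticAt_companionE hconv hR

theorem continuation_unique {F : ℍ → ℂ}
    (hF : DifferentiableOn ℂ (F ∘ ofComplex) {z : ℂ | 0 < z.im})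
    (h : ∃ c : ℝ, ∀ τ : ℍ, c < τ.im → F τ = companionE τ) (τ : ℍ) : F τ = eichlerSeries a τ := by
  obtain ⟨c, hc⟩ := h
  obtain ⟨c', hc'⟩ := exists_companionE_eq
  refine eq_of_analytic_of_halfPlane (U := Set.univ) (c := max c c') isPreconnected_univ
    (fun σ _ => analyticAt_of_mdiff (UpperHalfPlane.mdifferentiable_iff.mpr hF) σ)
    (fun σ _ => analyticAt_of_mdiff mdiff_eichlerSeries σ) ⟨0, fun _ _ => trivial⟩
    (fun σ hσ => ?_) (Set.mem_univ τ)
  rw [hc σ ((le_max_left _ _).trans_lt hσ), hc' σ ((le_max_right _ _).trans_lt hσ)]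

/-! ### The Eichler integral -/

open MeasureTheory

/-- The point `τ + i y`. -/
def up (τ : ℍ) (y : ℝ) (hy : 0 < y) : ℍ := ⟨(τ : ℂ) + Complex.I * y, by
  have := τ.im_pos
  simp only [Complex.add_im, coe_im, Complex.mul_im, Complex.I_re, Complex.I_im,
    Complex.ofReal_re, Complex.ofReal_im]
  linarith⟩

theorem ofComplex_up (τ : ℍ) {y : ℝ} (hy : 0 < y) :
    ofComplex ((τ : ℂ) + Complex.I * y) = up τ y hy :=
  ofComplex_apply (up τ y hy)

theorem q_up (τ : ℍ) {y : ℝ} (hy : 0 < y) :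
    q (up τ y hy) = q τ * (Real.exp (-(2 * π * y)) : ℝ) := by
  rw [q, q, Complex.ofReal_exp, ← Complex.exp_add]
  congr 1
  change 2 * (π : ℂ) * Complex.I * (τ + Complex.I * y) = _
  push_cast
  linear_combination 2 * (π : ℂ) * y * Complex.I_sq

/-- The contribution of `aₙ qⁿ` to the Eichler integrand. -/
def modeIntegrand (τ : ℍ) (n : ℕ+) (y : ℝ) : ℂ :=
  coeffA n * q τ ^ (n : ℕ) * -Complex.I * ((y ^ 2 * Real.exp (-(2 * π * n * y)) : ℝ) : ℂ)

theorem integral_sq_mul_exp {b : ℝ} (hb : 0 < b) :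
    ∫ y in Set.Ioi (0 : ℝ), y ^ 2 * Real.exp (-(b * y)) = 2 / b ^ 3 := by
  have h := Real.integral_rpow_mul_exp_neg_mul_Ioi (a := 3) (by norm_num) hb
  have h3 : Real.Gamma 3 = 2 := by
    have := Real.Gamma_nat_eq_factorial 2
    rw [show ((2 : ℕ) : ℝ) + 1 = 3 by norm_num] at this
    rw [this]; norm_num [Nat.factorial]
  rw [h3] at h
  norm_num at h
  rw [h]; field_simp

theorem integrableOn_sq_mul_exp {b : ℝ} (hb : 0 < b) :
    IntegrableOn (fun y : ℝ => y ^ 2 * Real.exp (-(b * y))) (Set.Ioi 0) := by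
  have h := integrableOn_rpow_mul_exp_neg_mul_rpow (p := 1) (s := 2) (b := b) (by norm_num)
    one_pos hb
  refine h.congr_fun (fun y _ => ?_) measurableSet_Ioi
  norm_num

theorem hasSum_modeIntegrand (τ : ℍ) {y : ℝ} (hy : 0 < y) :
    HasSum (fun n => modeIntegrand τ n y) (eichlerIntegrand g8 τ y) := by
  have h := ((hasSum_g8 (up τ y hy)).mul_right ((Complex.I * y) ^ 2 * Complex.I))
  rw [eichlerIntegrand, ofComplex_up τ hy, mul_assoc]
  refine h.congr_fun fun n => ?_
  rw [modeIntegrand, q_up, mul_pow, ← Complex.ofReal_pow (Real.exp _), ← Real.exp_nat_mul,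
    show (((n : ℕ) : ℝ) * -(2 * π * y)) = -(2 * π * n * y) by ring, coeffA]
  push_cast
  linear_combination -((a n : ℂ) * q τ ^ (n : ℕ) * y ^ 2 * Complex.exp (-(2 * π * n * y)) *
    Complex.I) * Complex.I_sq

theorem two_pi_mul_pos (n : ℕ+) : 0 < 2 * π * (n : ℝ) := by
  have : (0 : ℝ) < n := by exact_mod_cast n.pos
  positivity

theorem integrableOn_modeIntegrand (τ : ℍ) (n : ℕ+) :
    IntegrableOn (modeIntegrand τ n) (Set.Ioi 0) :=
  ((integrableOn_sq_mul_exp (two_pi_mul_pos n)).ofReal).const_mul _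

theorem integral_modeIntegrand (τ : ℍ) (n : ℕ+) :
    ∫ y in Set.Ioi (0 : ℝ), modeIntegrand τ n y =
      coeffA n * q τ ^ (n : ℕ) * -Complex.I * (2 / (2 * π * n) ^ 3) := by
  simp only [modeIntegrand]
  rw [integral_const_mul, integral_complex_ofReal, integral_sq_mul_exp (two_pi_mul_pos n)]
  push_cast; rfl

theorem integral_norm_modeIntegrand (τ : ℍ) (n : ℕ+) :
    ∫ y in Set.Ioi (0 : ℝ), ‖modeIntegrand τ n y‖ =
      ‖coeffA n‖ * ‖q τ‖ ^ (n : ℕ) * (2 / (2 * π * n) ^ 3) := by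
  rw [← integral_sq_mul_exp (two_pi_mul_pos n), ← integral_const_mul]
  congr 1; ext y
  rw [modeIntegrand, norm_mul, norm_mul, norm_mul, norm_neg, Complex.norm_I, mul_one, norm_pow,
    Complex.norm_real, Real.norm_of_nonneg (by positivity)]

theorem summable_norm_coeffA (τ : ℍ) :
    Summable fun n : ℕ+ => ‖coeffA n‖ * ‖q τ‖ ^ (n : ℕ) :=
  (convergesIn_coeffA _ (norm_nonneg _) (norm_q_lt_one τ)).comp_injective PNat.coe_injective

theorem one_le_two_pi_mul (n : ℕ+) : 1 ≤ 2 * π * (n : ℝ) := by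
  have h1 : (1 : ℝ) ≤ n := by exact_mod_cast n.pos
  nlinarith [Real.pi_gt_three]

/-- Sum and integral are exchanged by absolute convergence. The constants match because `-(2πi)³/2 ·
(-i) · 2/(2πn)³ = i⁴/n³ = 1/n³`. -/
theorem eichlerSeries_eq_eichlerIntegral (τ : ℍ) :
    eichlerSeries a τ = eichlerIntegral g8 τ := by
  have hsum : Summable fun n : ℕ+ => ∫ y in Set.Ioi (0 : ℝ), ‖modeIntegrand τ n y‖ := by
    refine ((summable_norm_coeffA τ).mul_right 2).of_nonneg_of_le
      (fun n => integral_nonneg fun y => norm_nonneg _) fun n => ?_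
    rw [integral_norm_modeIntegrand]
    exact mul_le_mul_of_nonneg_left (div_le_self (by norm_num)
      (one_le_pow₀ (one_le_two_pi_mul n))) (by positivity)
  have h := hasSum_integral_of_summable_integral_norm (integrableOn_modeIntegrand τ) hsum
  have he : ∫ y in Set.Ioi (0 : ℝ), ∑' n : ℕ+, modeIntegrand τ n y =
      ∫ y in Set.Ioi (0 : ℝ), eichlerIntegrand g8 τ y :=
    setIntegral_congr_fun measurableSet_Ioi fun y hy => (hasSum_modeIntegrand τ hy).tsum_eq
  rw [he] at h
  rw [eichlerIntegral, ← (h.mul_left _).tsum_eq, eichlerSeries]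
  congr 1; ext n
  have hn : (n : ℂ) ≠ 0 := by exact_mod_cast n.ne_zero
  have hpi : (π : ℂ) ≠ 0 := by exact_mod_cast Real.pi_ne_zero
  rw [integral_modeIntegrand, eichlerTerm, coeffA]
  field_simp
  linear_combination (-(Complex.I ^ 2 - 1) * (a n : ℂ) * q τ ^ (n : ℕ)) * Complex.I_sq

/-- Every mode has `n ≥ 1`, so `y² exp(-2πy) ∑ |aₙ| |q|ⁿ` dominates the integrand on the whole ray.
-/
theorem integrableOn_eichlerIntegrand (τ : ℍ) :
    IntegrableOn (eichlerIntegrand g8 τ) (Set.Ioi 0) := by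
  have hcont : ContinuousOn (eichlerIntegrand g8 τ) (Set.Ioi 0) := by
    have h1 : ContinuousOn (fun y : ℝ => (g8 ∘ ofComplex) ((τ : ℂ) + Complex.I * y))
        (Set.Ioi 0) :=
      (UpperHalfPlane.mdifferentiable_iff.mp mdiff_g8).continuousOn.comp (by fun_prop)
        fun y hy => (up τ y hy).im_pos
    exact (h1.mul (by fun_prop)).mul continuousOn_const
  have hdom := (integrableOn_sq_mul_exp Real.two_pi_pos).const_mul
    (∑' n : ℕ+, ‖coeffA n‖ * ‖q τ‖ ^ (n : ℕ))
  refine Integrable.mono' hdom (hcont.aestronglyMeasurable measurableSet_Ioi) ?_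
  refine (ae_restrict_iff' measurableSet_Ioi).mpr (Eventually.of_forall fun y hy => ?_)
  have hy' : 0 < y := hy
  rw [← (hasSum_modeIntegrand τ hy').tsum_eq]
  have hs := (summable_norm_coeffA τ).mul_right (y ^ 2 * Real.exp (-(2 * π * y)))
  rw [← tsum_mul_right]
  refine tsum_of_norm_bounded hs.hasSum fun n => ?_
  rw [modeIntegrand, norm_mul, norm_mul, norm_mul, norm_neg, Complex.norm_I, mul_one, norm_pow,
    Complex.norm_real, Real.norm_of_nonneg (by positivity)]
  have h1 : (1 : ℝ) ≤ n := by exact_mod_cast n.pos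
  have h2 : 2 * π * y ≤ 2 * π * n * y := by
    have : 0 ≤ 2 * π * y := by positivity
    nlinarith
  gcongr

theorem exists_summable_companionTerm :
    ∃ c : ℝ, ∀ τ : ℍ, c < τ.im → Summable (companionTerm τ) := by
  obtain ⟨c, hc⟩ := exists_norm_t_lt
  exact ⟨c, fun τ hτ => (convergesIn_coeffB.hasSum (hc τ hτ)).summable⟩

theorem hasSum_companionTerm {τ : ℍ} (hs : Summable (companionTerm τ))
    (h : companionE τ = eichlerSeries a τ) :
    HasSum (companionTerm τ) (eichlerSeries a τ * Y τ) := by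
  rw [← h, companionE, div_mul_cancel₀ _ (Y_ne_zero τ)]
  exact hs.hasSum

end LevelEight

end

theorem mainTheorem4 :
    -- `Φ = g₈`, pointwise off the zeros of the denominator, and as holomorphic functions
    -- (the singularities of `Φ` at those zeros are removable, with value `g₈` there)
    (∀ τ : ℍ, 1 - 24 * LevelEight.t τ + 16 * LevelEight.t τ ^ 2 ≠ 0 →
      LevelEight.Phi τ = LevelEight.g8 τ) ∧
    (∀ τ : ℍ, Tendsto LevelEight.Phi (𝓝[≠] τ) (𝓝 (LevelEight.g8 τ))) ∧
    -- `g₈ = ∑ aₙ qⁿ`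
    (∀ τ : ℍ, HasSum
      (fun n : ℕ+ => ((LevelEight.a n : ℤ) : ℂ) * LevelEight.q τ ^ (n : ℕ))
      (LevelEight.g8 τ)) ∧
    -- the Eichler integral of `g₈` is holomorphic on the upper half-plane, as a convergent
    -- series and as a convergent integral
    (∀ τ : ℍ, Summable (LevelEight.eichlerTerm LevelEight.a τ)) ∧
    (∀ τ : ℍ, MeasureTheory.IntegrableOn
      (LevelEight.eichlerIntegrand LevelEight.g8 τ) (Set.Ioi (0 : ℝ))) ∧
    (∀ τ : ℍ, LevelEight.eichlerSeries LevelEight.a τ =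
      LevelEight.eichlerIntegral LevelEight.g8 τ) ∧
    DifferentiableOn ℂ (LevelEight.eichlerSeries LevelEight.a ∘ ofComplex) {z : ℂ | 0 < z.im} ∧
    -- `∑ Bₙ t(τ)ⁿ` converges near `i∞`
    (∃ c : ℝ, ∀ τ : ℍ, c < τ.im → Summable (LevelEight.companionTerm τ)) ∧
    -- the only holomorphic continuation of `E` from a half-plane `Im τ > c` to the whole upper
    -- half-plane is that Eichler integral
    (∀ F : ℍ → ℂ, DifferentiableOn ℂ (F ∘ ofComplex) {z : ℂ | 0 < z.im} →
      (∃ c : ℝ, ∀ τ : ℍ, c < τ.im → F τ = LevelEight.companionE τ) →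
      ∀ τ : ℍ, F τ = LevelEight.eichlerSeries LevelEight.a τ) ∧
    -- `E = ∑ (aₙ / n³) qⁿ` and `∑ Bₙ t(τ)ⁿ = E(τ) Y(τ)` on every domain of convergence
    -- that reaches `i∞`
    (∀ U : Set ℍ, IsOpen U → IsConnected U → LevelEight.ContainsHalfPlane U →
      (∀ τ ∈ U, Summable (LevelEight.companionTerm τ)) →
      ∀ τ ∈ U,
        LevelEight.companionE τ = LevelEight.eichlerSeries LevelEight.a τ ∧
        LevelEight.companionE τ = LevelEight.eichlerIntegral LevelEight.g8 τ ∧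
        HasSum (LevelEight.companionTerm τ)
          (LevelEight.eichlerSeries LevelEight.a τ * LevelEight.Y τ)) :=
  ⟨LevelEight.Phi_eq, LevelEight.tendsto_Phi, LevelEight.hasSum_g8,
    fun τ => (LevelEight.hasSum_eichlerTerm τ).summable,
    LevelEight.integrableOn_eichlerIntegrand, LevelEight.eichlerSeries_eq_eichlerIntegral,
    UpperHalfPlane.mdifferentiable_iff.mp LevelEight.mdiff_eichlerSeries,
    LevelEight.exists_summable_companionTerm,
    fun _ hF h => LevelEight.continuation_unique hF h,
    fun _ hU hconn hUc hs τ hτ =>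
      have h := LevelEight.companionE_eq_eichlerSeries hU hconn hUc hs hτ
      ⟨h, h.trans (LevelEight.eichlerSeries_eq_eichlerIntegral τ),
        LevelEight.hasSum_companionTerm (hs τ hτ) h⟩⟩
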